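/- Let $H$ be a Hermitian operator (the Hamiltonian) and $A^a$, $a\in\mathbf A$ ($\mathbf A$ finite), Hermitian jump operators on a finite-dimensional Hilbert space, $\{p_a\}$ a probability distribution on $\mathbf A$, $\gamma\ge 0$, $\beta,t,\varepsilon>0$. Put $$g(s)=\frac{1}{\pi^{3/4}\beta^{1/2}}\,e^{is/\beta}e^{-2s^2/\beta^2},\qquad A^a(s)=e^{iHs}A^ae^{-iHs},\qquad L^a=\int_{-\infty}^{\infty}g(s)\,A^a(s)\,ds,$$ $$\mathcal L[\rho]=\sum_{a}p_a\Big(-i[H,\rho]+\gamma\big(L^a\rho L^{a\dagger}-\tfrac12\{L^{a\dagger}L^a,\rho\}\big)\Big).$$ **Protocol** with parameters $M,S\in\mathbb N_{\ge1}$, $\Delta>0$. Put $\delta=t/M$, $\Delta_s=\Delta$ for $|s|<S$, $\Delta_{\pm S}=\Delta/2$, $g_s=g(s\Delta)$. With one ancilla qubit (Pauli operators $X,Y$), let $$B^a_s=\exp\Big[-i\tfrac{\sqrt{\delta\gamma}}{2}\Delta_s(\mathrm{Re}\,g_s\,X+\mathrm{Im}\,g_s\,Y)\otimes A^a\Big],$$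 $$V^a=B^a_{-S}e^{iH\Delta}B^a_{-S+1}\cdots e^{iH\Delta}B^a_S\;B^a_Se^{-iH\Delta}\cdots B^a_{-S+1}e^{-iH\Delta}B^a_{-S}.$$ Starting from $\rho_0$, apply $e^{iHS\Delta}$; then, for $i=1,\dots,M$, draw $a_i$ independently with law $p$, apply $e^{-iH\delta}$ to the system, apply $V^{a_i}$ to system and ancilla (ancilla prepared in $|0\rangle$), and reset the ancilla to $|0\rangle$; finally apply $e^{-iHS\Delta}$. The output is the state of the system averaged over $a_1,\dots,a_M$. The total Hamiltonian simulation time of a run is the sum of $|\tau|$ over all evolutions $e^{-iH\tau}$ that it applies. **Theorem.** For every $\kappa>0$ there are constants $c,C>0$, depending only on $\kappa$, such that for all data as above with $\gamma\max(1,\beta)\,\|A^a\|_\infty^2\le\kappa$ for all $a$, $\beta t/\varepsilon\ge2$ and $\varepsilon\le t^2$, there are parameters $M,S,\Delta$ for which the output $\rho_{\rm out}$ of the protocol satisfies $$\big\|e^{t\mathcal L}[\rho_0]-\rho_{\rm out}\big\|_1\le\varepsilon\quad\text{for every density matrix }\rho_0,$$ and the total Hamiltonian simulation time $T_{\rm tot}$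 of every run satisfies $$c\;\frac{\beta t^2}{\varepsilon}\sqrt{\log\frac{\beta t}{\varepsilon}}\;\le\;T_{\rm tot}\;\le\;C\;\frac{\beta t^2}{\varepsilon}\sqrt{\log\frac{\beta t}{\varepsilon}},$$ that is, $T_{\rm tot}=\Theta\big(\frac{\beta t^2}{\varepsilon}\sqrt{\log\frac{\beta t}{\varepsilon}}\big)$. -/

import Mathlib

open scoped Matrix Kronecker Matrix.Norms.L2Operator ComplexOrder

noncomputable section

namespace LindbladSim

/-- The Schatten 1-norm `‖X‖₁ = Tr √(Xᴴ X)`, the sum of the singular values of `X`. -/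
def traceNorm {d : Type} [Fintype d] [DecidableEq d] (X : Matrix d d ℂ) : ℝ :=
  ∑ i, √((Matrix.isHermitian_conjTranspose_mul_self X).eigenvalues i)

/-- Density matrices. -/
def IsDensity {d : Type} [Fintype d] [DecidableEq d] (ρ : Matrix d d ℂ) : Prop :=
  ρ.PosSemidef ∧ ρ.trace = 1

/-- The filter `g(s) = π^{-3/4} β^{-1/2} exp(i s/β) exp(-2 s²/β²)`. -/
def filter (β s : ℝ) : ℂ :=
  ((1 / (Real.pi ^ (3 / 4 : ℝ) * √β) : ℝ) : ℂ)
    * Complex.exp (Complex.I * ((s / β : ℝ) : ℂ))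
    * ((Real.exp (-2 * s ^ 2 / β ^ 2) : ℝ) : ℂ)

section System

variable {d : Type} [Fintype d] [DecidableEq d]

/-- Time evolution `exp(-i H τ)`. -/
def evolution (H : Matrix d d ℂ) (τ : ℝ) : Matrix d d ℂ :=
  NormedSpace.exp ((-(Complex.I * (τ : ℂ))) • H)

/-- Heisenberg evolution `A(s) = exp(i H s) A exp(-i H s)`. -/
def heisenberg (H A : Matrix d d ℂ) (s : ℝ) : Matrix d d ℂ :=
  evolution H (-s) * A * evolution H s

/-- The Lindblad operator `L = ∫ g(s) A(s) ds`: the operator Fourier transform of `A`. -/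
def jump (β : ℝ) (H A : Matrix d d ℂ) : Matrix d d ℂ :=
  ∫ s : ℝ, filter β s • heisenberg H A s

/-- The dissipator `ρ ↦ L ρ Lᴴ - (1/2) (Lᴴ L ρ + ρ Lᴴ L)`. -/
def dissipator (L ρ : Matrix d d ℂ) : Matrix d d ℂ :=
  L * ρ * Lᴴ - (1 / 2 : ℂ) • (Lᴴ * L * ρ + ρ * (Lᴴ * L))

/-- The Lindbladian
`ρ ↦ ∑ a, p a (-i [H, ρ] + γ (L_a ρ L_aᴴ - (1/2) {L_aᴴ L_a, ρ}))`. -/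
def lindbladian {ι : Type} [Fintype ι] (H : Matrix d d ℂ) (L : ι → Matrix d d ℂ)
    (p : ι → ℝ) (γ : ℝ) : Matrix d d ℂ →L[ℂ] Matrix d d ℂ :=
  LinearMap.toContinuousLinearMap
    { toFun := fun ρ => ∑ a, (p a : ℂ) •
        ((-Complex.I) • (H * ρ - ρ * H) + (γ : ℂ) • dissipator (L a) ρ)
      map_add' := by
        intro x y
        rw [← Finset.sum_add_distrib]
        refine Finset.sum_congr rfl fun a _ => ?_
        simp only [dissipator, mul_add, add_mul]
        module
      map_smul' := by
        intro c x
        rw [Finset.smul_sum]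
        refine Finset.sum_congr rfl fun a _ => ?_
        simp only [dissipator, Matrix.mul_smul, Matrix.smul_mul, RingHom.id_apply]
        module }

end System

/-! The circuits: one ancilla qubit (the factor `Fin 2`) next to the system. -/

def pauliX : Matrix (Fin 2) (Fin 2) ℂ := !![0, 1; 1, 0]

def pauliY : Matrix (Fin 2) (Fin 2) ℂ := !![0, -Complex.I; Complex.I, 0]

/-- The ancilla state `|0⟩⟨0|`. -/
def anc0 : Matrix (Fin 2) (Fin 2) ℂ := !![1, 0; 0, 0]

/-- Operations of the single-ancilla circuits. `evolve τ` is Hamiltonian simulation, the unitary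
`I ⊗ exp(-i H τ)`; `couple a w` is the gate `exp(-i (Re w X + Im w Y) ⊗ A a)`; `reset` discards
the ancilla and prepares it again in `|0⟩`. -/
inductive Op (ι : Type) : Type where
  | evolve (τ : ℝ) : Op ι
  | couple (a : ι) (w : ℂ) : Op ι
  | reset : Op ι

/-- Hamiltonian simulation time used by one operation. -/
def Op.time {ι : Type} : Op ι → ℝ
  | .evolve τ => |τ|
  | .couple _ _ => 0
  | .reset => 0

/-- Total Hamiltonian simulation time of a circuit. -/
def simulationTime {ι : Type} (c : List (Op ι)) : ℝ := (c.map Op.time).sum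

section Semantics

variable {d ι : Type} [Fintype d] [DecidableEq d]

/-- The partial trace over the ancilla. -/
def traceAnc (X : Matrix (Fin 2 × d) (Fin 2 × d) ℂ) : Matrix d d ℂ :=
  Matrix.of fun i j => ∑ k : Fin 2, X (k, i) (k, j)

def coupling (A : Matrix d d ℂ) (w : ℂ) : Matrix (Fin 2 × d) (Fin 2 × d) ℂ :=
  NormedSpace.exp ((-Complex.I) • (((w.re : ℂ) • pauliX + (w.im : ℂ) • pauliY) ⊗ₖ A))

/-- The action of one operation on states of ancilla and system. -/
def Op.apply (H : Matrix d d ℂ) (A : ι → Matrix d d ℂ) :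
    Op ι → Matrix (Fin 2 × d) (Fin 2 × d) ℂ → Matrix (Fin 2 × d) (Fin 2 × d) ℂ
  | .evolve τ, X =>
      ((1 : Matrix (Fin 2) (Fin 2) ℂ) ⊗ₖ evolution H τ) * X
        * ((1 : Matrix (Fin 2) (Fin 2) ℂ) ⊗ₖ evolution H τ)ᴴ
  | .couple a w, X => coupling (A a) w * X * (coupling (A a) w)ᴴ
  | .reset, X => anc0 ⊗ₖ traceAnc X

/-- The system state after running the circuit `c` (first operation of the list first) on
`|0⟩⟨0| ⊗ ρ` and discarding the ancilla. -/
def runCircuit (H : Matrix d d ℂ) (A : ι → Matrix d d ℂ) (c : List (Op ι))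
    (ρ : Matrix d d ℂ) : Matrix d d ℂ :=
  traceAnc (c.foldl (fun X o => o.apply H A X) (anc0 ⊗ₖ ρ))

end Semantics

section Protocol

variable {ι : Type}

/-- Trapezoidal weights on the grid `s_j = (j - S) Δ`, `j = 0, …, 2S`. -/
def trapWeight (S : ℕ) (Δ : ℝ) (j : ℕ) : ℝ := if j = 0 ∨ j = 2 * S then Δ / 2 else Δ

/-- The coefficient `(√(δ γ) / 2) Δ_j g(s_j)` of the `j`-th factor of the product formula. -/
def couplingCoeff (β γ δ : ℝ) (S : ℕ) (Δ : ℝ) (j : ℕ) : ℂ :=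
  ((√(δ * γ) / 2 * trapWeight S Δ j : ℝ) : ℂ) * filter β (((j : ℝ) - (S : ℝ)) * Δ)

/-- The second-order product formula with jump label `a`, in order of application:
`B_0, exp(-iHΔ), B_1, …, exp(-iHΔ), B_{2S}, B_{2S}, exp(iHΔ), …, B_1, exp(iHΔ), B_0`. -/
def productFormula (β γ δ : ℝ) (S : ℕ) (Δ : ℝ) (a : ι) : List (Op ι) :=
  ((List.range (2 * S)).flatMap fun j =>
      [Op.couple a (couplingCoeff β γ δ S Δ j), Op.evolve Δ])
    ++ [Op.couple a (couplingCoeff β γ δ S Δ (2 * S)),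
        Op.couple a (couplingCoeff β γ δ S Δ (2 * S))]
    ++ ((List.range (2 * S)).reverse.flatMap fun j =>
      [Op.evolve (-Δ), Op.couple a (couplingCoeff β γ δ S Δ j)])

/-- One step of the protocol: coherent evolution, dissipative step, reset of the ancilla. -/
def protocolStep (β γ δ : ℝ) (S : ℕ) (Δ : ℝ) (a : ι) : List (Op ι) :=
  [Op.evolve δ] ++ productFormula β γ δ S Δ a ++ [Op.reset]

/-- The whole circuit for the sequence `a₁, …, a_M` of sampled jump labels. Between consecutive
steps the evolutions `exp(± i H S Δ)` that surround each product formula cancel; only the first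
and the last remain. -/
def protocol (β γ δ : ℝ) (S : ℕ) (Δ : ℝ) (as : List ι) : List (Op ι) :=
  [Op.evolve (-((S : ℝ) * Δ))] ++ as.flatMap (protocolStep β γ δ S Δ)
    ++ [Op.evolve ((S : ℝ) * Δ)]

/-- The output of the protocol with `M` steps of length `t / M`, averaged over independent
labels `a₁, …, a_M` with law `p`. -/
def protocolOutput {d : Type} [Fintype d] [DecidableEq d] [Fintype ι]
    (H : Matrix d d ℂ) (A : ι → Matrix d d ℂ) (p : ι → ℝ) (β γ t : ℝ)
    (M S : ℕ) (Δ : ℝ) (ρ : Matrix d d ℂ) : Matrix d d ℂ :=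
  ∑ a : Fin M → ι, ((∏ i, p (a i) : ℝ) : ℂ) •
    runCircuit H A (protocol β γ (t / M) S Δ (List.ofFn a)) ρ

end Protocol

/-- The complexity `(β t² / ε) √(log (β t / ε))`. -/
def rate (β t ε : ℝ) : ℝ := β * t ^ 2 / ε * √(Real.log (β * t / ε))

end LindbladSim

end

/-!
Approximation of a Lindblad evolution with Gaussian-filtered jump operators by a randomized
product formula on the system and one ancilla qubit.

Both evolutions are compared in the Heisenberg picture, in the norm of operators acting on the
observables with the operator norm (`IsTraceDual`, `traceNorm_exp_sub_protocolOutput_le`). There the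
Lindblad semigroup and the mean step of the protocol are contractions
(`norm_exp_lindbladianDual_le`, `norm_meanStepDual_le`), so the errors of the `M` steps of length
`δ = t / M` add up (`norm_pow_sub_pow_le`), and it suffices that one step has an error `O(δ²)`
uniformly in the Hamiltonian, up to the error of the discretized jump operator. This has three
sources.

* *The product formula.* In the interaction picture one dissipative step is a palindromic product of
  unitaries `exp Gⱼ` with total strength `x = O(√δ)`, because the evolutions between the gates
  telescope (`actsBy_productFormula`). Reversing the product takes adjoints with the opposite signs,
  so its skew-Hermitian part is `∑ Gⱼ` up to `O(x³)`, and the Pauli operator `Z` of the ancilla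
  identifies this part with the block producing a jump, while the no-jump block is Hermitian and
  therefore determined by unitarity. Hence the channel is `1` plus the dissipator of the summed jump
  operator up to `O(x⁴) = O(δ²)` (`norm_dilationDual_palindrome_sub_le`).
* *Splitting coherent and dissipative parts.* The first-order splitting error contains the
  Hamiltonian only through its commutator with the dissipator
  (`norm_exp_add_sub_exp_mul_le`), which involves only `[H, L]`; an integration by parts
  puts this derivative of the Heisenberg evolution on the filter, which bounds it independently of
  `H` (`norm_commutator_jump_le`).
* *Discretization.* The spacing `Δ` is free and does not enter the simulation time once the
  half-width `T = S Δ` of the grid is fixed. Letting `S → ∞` turns the trapezoidal sum into the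
  integral over `[-T, T]` (`tendsto_trapezoidal_sum`), so only the Gaussian tail
  `exp (-(T / β)²)` remains, which is small enough for `T = O(β √(log (β t / ε)))` (`tail_le`).

With `M` of order `t² / ε` the error is at most `ε`. The simulation time is `t + 4 M T + 2 T`, where
`M T` is of the order of the rate and dominates.
-/

namespace LindbladSim

/-! ### Exponentials in Banach algebras -/

section BanachAlgebra

open NormedSpace Filter Topology

variable {𝔸 : Type*} [NormedRing 𝔸] [NormedAlgebra ℂ 𝔸] [CompleteSpace 𝔸]

/-- Taylor remainders of the exponential in a Banach algebra are dominated by the scalar ones. The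
hypothesis on `1` concerns only the zeroth term; it also admits the trivial algebra. -/
lemma norm_exp_sub_taylor_le (h1 : ‖(1 : 𝔸)‖ ≤ 1) (x : 𝔸) (n : ℕ) :
    ‖exp x - ∑ k ∈ Finset.range n, ((k.factorial : ℂ)⁻¹) • x ^ k‖
      ≤ Real.exp ‖x‖ - ∑ k ∈ Finset.range n, ((k.factorial : ℝ)⁻¹) * ‖x‖ ^ k := by
  have hs : HasSum (fun k : ℕ => ((k.factorial : ℂ)⁻¹) • x ^ k) (exp x) :=
    exp_series_hasSum_exp' (𝕂 := ℂ) x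
  have hr : HasSum (fun k : ℕ => ((k.factorial : ℝ)⁻¹) * ‖x‖ ^ k) (Real.exp ‖x‖) := by
    rw [Real.exp_eq_exp_ℝ]
    simpa using exp_series_hasSum_exp' (𝕂 := ℝ) ‖x‖
  have hs' := (hasSum_nat_add_iff' n).2 hs
  have hr' := (hasSum_nat_add_iff' n).2 hr
  refine hs'.norm_le_of_bounded hr' fun k => ?_
  rw [norm_smul, norm_inv, Complex.norm_natCast]
  gcongr
  rcases Nat.eq_zero_or_pos (k + n) with h | h
  · rw [h]; simpa using h1
  · exact norm_pow_le' x h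

lemma norm_exp_le_exp_norm (h1 : ‖(1 : 𝔸)‖ ≤ 1) (x : 𝔸) : ‖exp x‖ ≤ Real.exp ‖x‖ := by
  simpa using norm_exp_sub_taylor_le h1 x 0

lemma norm_exp_sub_one_le_exp (h1 : ‖(1 : 𝔸)‖ ≤ 1) (x : 𝔸) :
    ‖exp x - 1‖ ≤ Real.exp ‖x‖ - 1 := by
  simpa using norm_exp_sub_taylor_le h1 x 1

lemma norm_exp_sub_two_terms_le (h1 : ‖(1 : 𝔸)‖ ≤ 1) (x : 𝔸) :
    ‖exp x - 1 - x‖ ≤ Real.exp ‖x‖ - 1 - ‖x‖ := by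
  simpa [Finset.sum_range_succ, sub_sub] using norm_exp_sub_taylor_le h1 x 2

lemma norm_exp_sub_three_terms_le (h1 : ‖(1 : 𝔸)‖ ≤ 1) (x : 𝔸) :
    ‖exp x - 1 - x - (1 / 2 : ℂ) • x ^ 2‖ ≤ Real.exp ‖x‖ - 1 - ‖x‖ - ‖x‖ ^ 2 / 2 := by
  have := norm_exp_sub_taylor_le h1 x 3
  simp only [Finset.sum_range_succ, Finset.range_zero, Finset.sum_empty, zero_add, pow_zero,
    pow_one, Nat.factorial] at this
  refine (le_of_eq ?_).trans (this.trans (le_of_eq ?_))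
  · norm_num [sub_sub]
  · norm_num; ring

lemma exp_sub_one_le_mul_exp {x : ℝ} : Real.exp x - 1 ≤ x * Real.exp x := by
  have h := Real.add_one_le_exp (-x)
  have h2 := mul_le_mul_of_nonneg_right h (Real.exp_pos x).le
  rw [← Real.exp_add] at h2
  simp at h2
  linarith

lemma exp_sub_two_terms_le_sq_mul_exp {x : ℝ} (hx : 0 ≤ x) :
    Real.exp x - 1 - x ≤ x ^ 2 * Real.exp x := by
  nlinarith [exp_sub_one_le_mul_exp (x := x)]

lemma exp_sub_three_terms_le_cube_mul_exp {x : ℝ} (hx : 0 ≤ x) :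
    Real.exp x - 1 - x - x ^ 2 / 2 ≤ x ^ 3 * Real.exp x := by
  -- the difference is monotone, its derivative being nonnegative by the previous order
  have hmono : MonotoneOn (fun y : ℝ => y ^ 3 * Real.exp y - (Real.exp y - 1 - y - y ^ 2 / 2))
      (Set.Ici 0) := by
    have hd : ∀ y : ℝ, HasDerivAt
        (fun y : ℝ => y ^ 3 * Real.exp y - (Real.exp y - 1 - y - y ^ 2 / 2))
        (3 * y ^ 2 * Real.exp y + y ^ 3 * Real.exp y - (Real.exp y - 1 - y)) y := fun y => by
      have h1 := ((hasDerivAt_pow 3 y).mul (Real.hasDerivAt_exp y)).sub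
        ((((Real.hasDerivAt_exp y).sub_const 1).sub (hasDerivAt_id y)).sub
          ((hasDerivAt_pow 2 y).div_const 2))
      refine h1.congr_deriv ?_
      norm_num
    refine monotoneOn_of_deriv_nonneg (convex_Ici 0)
      (fun y _ => (hd y).continuousAt.continuousWithinAt)
      (fun y _ => (hd y).differentiableAt.differentiableWithinAt) fun y hy => ?_
    rw [interior_Ici] at hy
    have hy : 0 < y := hy
    rw [(hd y).deriv]
    have h := exp_sub_two_terms_le_sq_mul_exp hy.le
    have h3 : 0 ≤ y ^ 3 * Real.exp y := by positivity
    have h4 : 0 ≤ y ^ 2 * Real.exp y := by positivity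
    nlinarith
  have := hmono (Set.mem_Ici.2 le_rfl) (Set.mem_Ici.2 hx) hx
  simp at this
  linarith

/-- A semigroup is contractive as soon as its Euler steps are contractive up to second order. -/
lemma norm_exp_smul_le_one_of_quadratic (h1 : ‖(1 : 𝔸)‖ ≤ 1) (G : 𝔸) {C : ℝ}
    (hG : ∀ δ : ℝ, 0 ≤ δ → ‖1 + (δ : ℂ) • G‖ ≤ 1 + C * δ ^ 2) {s : ℝ} (hs : 0 ≤ s) :
    ‖exp ((s : ℂ) • G)‖ ≤ 1 := by
  set D : ℝ := C * s ^ 2 + (s * ‖G‖) ^ 2 * Real.exp (s * ‖G‖) with hD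
  have key : ∀ n : ℕ, ‖exp ((s : ℂ) • G)‖ ≤ Real.exp (D / (n + 1 : ℝ)) := by
    intro n
    have hn : (0 : ℝ) < n + 1 := by positivity
    set δ : ℝ := s / (n + 1) with hδ
    have hδ0 : 0 ≤ δ := by positivity
    have hδs : δ ≤ s := div_le_self hs (by linarith [(Nat.cast_nonneg n : (0 : ℝ) ≤ n)])
    have hpow : exp ((s : ℂ) • G) = exp ((δ : ℂ) • G) ^ (n + 1) := by
      let _ : NormedAlgebra ℚ 𝔸 := NormedAlgebra.restrictScalars ℚ ℂ 𝔸
      rw [← NormedSpace.exp_nsmul]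
      congr 1
      rw [← Nat.cast_smul_eq_nsmul ℂ, smul_smul, hδ]
      congr 1
      push_cast
      field_simp
    have hnorm : ‖(δ : ℂ) • G‖ = δ * ‖G‖ := by
      rw [norm_smul, Complex.norm_real, Real.norm_of_nonneg hδ0]
    have hstep : ‖exp ((δ : ℂ) • G)‖ ≤ 1 + D / (n + 1) ^ 2 := by
      have e1 := norm_exp_sub_two_terms_le h1 ((δ : ℂ) • G)
      have e2 := exp_sub_two_terms_le_sq_mul_exp (norm_nonneg ((δ : ℂ) • G))
      have e3 : ‖exp ((δ : ℂ) • G)‖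
          ≤ ‖1 + (δ : ℂ) • G‖ + ‖exp ((δ : ℂ) • G) - 1 - (δ : ℂ) • G‖ := by
        refine le_trans (le_of_eq ?_) (norm_add_le _ _)
        congr 1; abel
      have e4 : (δ * ‖G‖) ^ 2 * Real.exp (δ * ‖G‖) ≤ (δ * ‖G‖) ^ 2 * Real.exp (s * ‖G‖) := by
        gcongr
      have e5 : C * δ ^ 2 + (δ * ‖G‖) ^ 2 * Real.exp (s * ‖G‖) = D / (n + 1) ^ 2 := by
        rw [hD, hδ]; field_simp
      rw [hnorm] at e1 e2
      linarith [hG δ hδ0]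
    rw [hpow]
    calc ‖exp ((δ : ℂ) • G) ^ (n + 1)‖ ≤ ‖exp ((δ : ℂ) • G)‖ ^ (n + 1) := norm_pow_le' _ n.succ_pos
      _ ≤ Real.exp (D / (n + 1) ^ 2) ^ (n + 1) := by
          gcongr
          exact hstep.trans (by linarith [Real.add_one_le_exp (D / ((n : ℝ) + 1) ^ 2)])
      _ = Real.exp (D / (n + 1)) := by
          rw [← Real.exp_nat_mul]
          congr 1
          push_cast
          field_simp
  have hlim : Tendsto (fun n : ℕ => Real.exp (D / (n + 1 : ℝ))) atTop (𝓝 1) := by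
    have h0 : Tendsto (fun n : ℕ => D / (n + 1 : ℝ)) atTop (𝓝 0) :=
      tendsto_const_div_atTop_nhds_zero_nat D |>.comp (tendsto_add_atTop_nat 1) |>.congr
        (by intro n; simp)
    simpa [Function.comp_def] using (Real.continuous_exp.tendsto 0).comp h0
  exact ge_of_tendsto' hlim key

lemma hasDerivAt_exp_ofReal_smul (P : 𝔸) (s : ℝ) :
    HasDerivAt (fun s : ℝ => exp ((s : ℂ) • P)) (exp ((s : ℂ) • P) * P) s := by
  have := (hasDerivAt_exp_smul_const (𝕂 := ℂ) P (s : ℂ)).scomp s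
    (Complex.ofRealCLM.hasDerivAt (x := s))
  simpa [Function.comp_def] using this

lemma hasDerivAt_exp_ofReal_smul' (P : 𝔸) (s : ℝ) :
    HasDerivAt (fun s : ℝ => exp ((s : ℂ) • P)) (P * exp ((s : ℂ) • P)) s := by
  have := (hasDerivAt_exp_smul_const' (𝕂 := ℂ) P (s : ℂ)).scomp s
    (Complex.ofRealCLM.hasDerivAt (x := s))
  simpa [Function.comp_def] using this

lemma hasDerivAt_exp_neg_ofReal_smul (P : 𝔸) (s : ℝ) :
    HasDerivAt (fun s : ℝ => exp ((-s : ℂ) • P)) (-(exp ((-s : ℂ) • P) * P)) s := by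
  have h := hasDerivAt_exp_ofReal_smul (-P) s
  convert h using 1
  · ext s; simp
  · simp

lemma exp_neg_smul_mul_exp_smul (P : 𝔸) (s : ℂ) : exp ((-s) • P) * exp (s • P) = 1 := by
  let _ : NormedAlgebra ℚ 𝔸 := NormedAlgebra.restrictScalars ℚ ℂ 𝔸
  rw [neg_smul, ← NormedSpace.exp_add_of_commute (Commute.refl (s • P)).neg_left, neg_add_cancel,
    exp_zero]

/-- A first-order splitting error bound that sees the unbounded part `P` only through its
commutator with the perturbation `Q`. It is Duhamel's formula for `s ↦ exp (-s P) exp (s (P + Q))`,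
in differential form. -/
lemma norm_exp_add_sub_exp_mul_le (P Q : 𝔸)
    (hP : ∀ s : ℝ, ‖exp ((s : ℂ) • P)‖ ≤ 1)
    (hPQ : ∀ s : ℝ, 0 ≤ s → ‖exp ((s : ℂ) • (P + Q))‖ ≤ 1) {δ : ℝ} (hδ : 0 ≤ δ) :
    ‖exp ((δ : ℂ) • (P + Q)) - exp ((δ : ℂ) • P) * (1 + (δ : ℂ) • Q)‖
      ≤ δ ^ 2 * (‖P * Q - Q * P‖ + ‖Q‖ ^ 2) := by
  have hP' : ∀ s : ℝ, ‖exp ((-s : ℂ) • P)‖ ≤ 1 := fun s => by simpa using hP (-s)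
  -- the perturbation in the frame rotating with `P`
  set R : ℝ → 𝔸 := fun s => exp ((-s : ℂ) • P) * Q * exp ((s : ℂ) • P) with hR
  set F : ℝ → 𝔸 := fun s => exp ((-s : ℂ) • P) * exp ((s : ℂ) • (P + Q)) with hF
  have hRd : ∀ s : ℝ, HasDerivAt R
      (exp ((-s : ℂ) • P) * (Q * P - P * Q) * exp ((s : ℂ) • P)) s := fun s => by
    have := ((hasDerivAt_exp_neg_ofReal_smul P s).mul_const Q).mul
      (hasDerivAt_exp_ofReal_smul' P s)
    refine this.congr_deriv ?_
    noncomm_ring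
  have hFd : ∀ s : ℝ, HasDerivAt F (R s * F s) s := fun s => by
    have := (hasDerivAt_exp_neg_ofReal_smul P s).mul (hasDerivAt_exp_ofReal_smul' (P + Q) s)
    refine this.congr_deriv (Eq.symm ?_)
    have h := exp_neg_smul_mul_exp_smul P (-s : ℂ)
    rw [neg_neg] at h
    calc R s * F s = exp ((-s : ℂ) • P) * Q * (exp ((s : ℂ) • P) * exp ((-s : ℂ) • P))
          * exp ((s : ℂ) • (P + Q)) := by rw [hR, hF]; noncomm_ring
      _ = _ := by rw [h]; noncomm_ring
  have hR0 : R 0 = Q := by simp [hR]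
  have hF0 : F 0 = 1 := by simp [hF]
  have hRn : ∀ s ∈ Set.Icc 0 δ, ‖R s - Q‖ ≤ ‖P * Q - Q * P‖ * δ := fun s hs => by
    have := norm_image_sub_le_of_norm_deriv_le_segment' (a := 0) (b := s)
      (fun x _ => (hRd x).hasDerivWithinAt) (C := ‖P * Q - Q * P‖) (fun x _ => ?_) s
      (Set.right_mem_Icc.2 hs.1)
    · rw [hR0, sub_zero] at this
      exact this.trans (by gcongr; exact hs.2)
    · refine (norm_mul_le _ _).trans ((mul_le_of_le_one_right (norm_nonneg _) (hP x)).trans ?_)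
      refine (norm_mul_le _ _).trans ((mul_le_of_le_one_left (norm_nonneg _) (hP' x)).trans ?_)
      rw [norm_sub_rev]
  have hFn : ∀ s : ℝ, 0 ≤ s → ‖F s‖ ≤ 1 := fun s hs =>
    (norm_mul_le _ _).trans (mul_le_one₀ (hP' s) (norm_nonneg _) (hPQ s hs))
  have hRQ : ∀ s : ℝ, ‖R s‖ ≤ ‖Q‖ := fun s => by
    refine (norm_mul_le _ _).trans ((mul_le_of_le_one_right (norm_nonneg _) (hP s)).trans ?_)
    exact (norm_mul_le _ _).trans (mul_le_of_le_one_left (norm_nonneg _) (hP' s))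
  have hF1 : ∀ s ∈ Set.Icc 0 δ, ‖F s - 1‖ ≤ ‖Q‖ * δ := fun s hs => by
    have := norm_image_sub_le_of_norm_deriv_le_segment' (a := 0) (b := s)
      (fun x _ => (hFd x).hasDerivWithinAt) (C := ‖Q‖) (fun x hx => ?_) s
      (Set.right_mem_Icc.2 hs.1)
    · rw [hF0, sub_zero] at this
      exact this.trans (by gcongr; exact hs.2)
    · exact (norm_mul_le _ _).trans ((mul_le_of_le_one_right (norm_nonneg _) (hFn x hx.1)).trans
        (hRQ x))
  have main := norm_image_sub_le_of_norm_deriv_le_segment' (a := 0) (b := δ)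
    (f := fun s => F s - (s : ℂ) • Q) (f' := fun s => R s * F s - Q)
    (fun x _ => ?_) (C := (‖P * Q - Q * P‖ + ‖Q‖ ^ 2) * δ) (fun x hx => ?_) δ
    (Set.right_mem_Icc.2 hδ)
  · have e : exp ((δ : ℂ) • (P + Q)) - exp ((δ : ℂ) • P) * (1 + (δ : ℂ) • Q)
        = exp ((δ : ℂ) • P) * ((F δ - (δ : ℂ) • Q) - (F 0 - ((0 : ℝ) : ℂ) • Q)) := by
      have h := exp_neg_smul_mul_exp_smul P (-δ : ℂ)
      rw [neg_neg] at h
      rw [hF0]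
      simp only [hF, mul_sub, ← mul_assoc, h, one_mul, Complex.ofReal_zero, zero_smul, mul_add,
        mul_one, sub_zero]
      abel
    rw [e]
    refine (norm_mul_le _ _).trans ((mul_le_of_le_one_left (norm_nonneg _) (hP δ)).trans ?_)
    refine main.trans (le_of_eq ?_)
    ring
  · refine ((hFd x).sub ?_).hasDerivWithinAt
    have : HasDerivAt (fun s : ℝ => (s : ℂ) • Q) ((1 : ℂ) • Q) x :=
      (Complex.ofRealCLM.hasDerivAt (x := x)).smul_const Q
    simpa using this
  · have hx' : x ∈ Set.Icc 0 δ := ⟨hx.1, hx.2.le⟩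
    have e : R x * F x - Q = (R x - Q) * F x + Q * (F x - 1) := by noncomm_ring
    rw [e]
    refine (norm_add_le _ _).trans ?_
    have h1 : ‖(R x - Q) * F x‖ ≤ ‖P * Q - Q * P‖ * δ :=
      (norm_mul_le _ _).trans ((mul_le_of_le_one_right (norm_nonneg _) (hFn x hx.1)).trans
        (hRn x hx'))
    have h2 : ‖Q * (F x - 1)‖ ≤ ‖Q‖ * (‖Q‖ * δ) :=
      (norm_mul_le _ _).trans (by gcongr; exact hF1 x hx')
    nlinarith

/-- Telescoping: powers of contractions differ by at most the number of factors times the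
difference of the contractions. -/
lemma norm_pow_sub_pow_le {𝔸 : Type*} [NormedRing 𝔸] {X Y : 𝔸} (hX : ‖X‖ ≤ 1)
    (hY : ‖Y‖ ≤ 1) (n : ℕ) :
    ‖X ^ n - Y ^ n‖ ≤ n * ‖X - Y‖ := by
  induction n with
  | zero => simp
  | succ n ih =>
    rcases Nat.eq_zero_or_pos n with rfl | hn
    · simp
    have e : X ^ (n + 1) - Y ^ (n + 1) = (X ^ n - Y ^ n) * X + Y ^ n * (X - Y) := by
      rw [pow_succ, pow_succ]; noncomm_ring
    rw [e]
    have hYn : ‖Y ^ n‖ ≤ 1 := (norm_pow_le' Y hn).trans (pow_le_one₀ (norm_nonneg _) hY)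
    calc _ ≤ ‖X ^ n - Y ^ n‖ * ‖X‖ + ‖Y ^ n‖ * ‖X - Y‖ :=
          (norm_add_le _ _).trans (add_le_add (norm_mul_le _ _) (norm_mul_le _ _))
      _ ≤ (n * ‖X - Y‖) * 1 + 1 * ‖X - Y‖ := by gcongr
      _ = _ := by push_cast; ring

end BanachAlgebra

/-! ### Ordered products of exponentials -/

section OrderedProducts

open NormedSpace

variable {𝔸 : Type*} [NormedRing 𝔸] [NormedAlgebra ℂ 𝔸]

/-- The second-order term of the ordered product `exp g₁ ⋯ exp gₙ`, that is
`∑ i, gᵢ² / 2 + ∑ i < j, gᵢ gⱼ`. -/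
noncomputable def secondOrder : List 𝔸 → 𝔸
  | [] => 0
  | g :: l => (1 / 2 : ℂ) • g ^ 2 + g * l.sum + secondOrder l

/-- The second-order term is even in the exponents. -/
lemma secondOrder_map_neg (l : List 𝔸) : secondOrder (l.map fun g => -g) = secondOrder l := by
  induction l with
  | nil => rfl
  | cons g l ih =>
    have hs : (l.map fun g => -g).sum = -l.sum := (List.sum_neg l).symm
    simp [secondOrder, ih, hs]

variable [CompleteSpace 𝔸]

/-- Errors of the Taylor approximations of orders zero to two of an ordered product of exponentials
are dominated by those of the scalar exponential. -/
lemma norm_prod_exp_sub_le (h1 : ‖(1 : 𝔸)‖ ≤ 1) (l : List 𝔸) :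
    ‖(l.map exp).prod‖ ≤ Real.exp (l.map norm).sum ∧
    ‖(l.map exp).prod - 1‖ ≤ Real.exp (l.map norm).sum - 1 ∧
    ‖(l.map exp).prod - 1 - l.sum‖ ≤ Real.exp (l.map norm).sum - 1 - (l.map norm).sum ∧
    ‖(l.map exp).prod - 1 - l.sum - secondOrder l‖
      ≤ Real.exp (l.map norm).sum - 1 - (l.map norm).sum - (l.map norm).sum ^ 2 / 2 := by
  induction l with
  | nil => simpa [secondOrder] using h1
  | cons g l ih =>
    obtain ⟨i0, i1, i2, i3⟩ := ih
    simp only [List.map_cons, List.prod_cons, List.sum_cons, secondOrder]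
    set P := (l.map exp).prod
    set x := (l.map norm).sum
    have e0 := norm_exp_le_exp_norm h1 g
    have e1 := norm_exp_sub_one_le_exp h1 g
    have e2 := norm_exp_sub_two_terms_le h1 g
    have e3 := norm_exp_sub_three_terms_le h1 g
    have hx := Real.exp_add ‖g‖ x
    have hg2 : ‖(1 / 2 : ℂ) • g ^ 2‖ ≤ ‖g‖ ^ 2 / 2 := by
      rw [norm_smul]
      have := norm_pow_le' g two_pos
      norm_num
      linarith
    refine ⟨?_, ?_, ?_, ?_⟩
    · rw [hx]
      exact (norm_mul_le _ _).trans (by gcongr)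
    · have e : exp g * P - 1 = (exp g - 1) * P + (P - 1) := by noncomm_ring
      have b1 : ‖(exp g - 1) * P‖ ≤ (Real.exp ‖g‖ - 1) * Real.exp x :=
        (norm_mul_le _ _).trans (mul_le_mul e1 i0 (norm_nonneg _) ((norm_nonneg _).trans e1))
      rw [e, hx]
      refine (norm_add_le _ _).trans ?_
      nlinarith
    · have e : exp g * P - 1 - (g + l.sum)
          = (exp g - 1 - g) * P + (P - 1 - l.sum) + g * (P - 1) := by noncomm_ring
      have b1 : ‖(exp g - 1 - g) * P‖ ≤ (Real.exp ‖g‖ - 1 - ‖g‖) * Real.exp x :=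
        (norm_mul_le _ _).trans (mul_le_mul e2 i0 (norm_nonneg _) ((norm_nonneg _).trans e2))
      have b2 : ‖g * (P - 1)‖ ≤ ‖g‖ * (Real.exp x - 1) :=
        (norm_mul_le _ _).trans (by gcongr)
      rw [e, hx]
      refine (norm_add₃_le).trans ?_
      nlinarith
    · have e : exp g * P - 1 - (g + l.sum) - ((1 / 2 : ℂ) • g ^ 2 + g * l.sum + secondOrder l)
          = (exp g - 1 - g - (1 / 2 : ℂ) • g ^ 2) * P + (P - 1 - l.sum - secondOrder l)
            + g * (P - 1 - l.sum) + ((1 / 2 : ℂ) • g ^ 2) * (P - 1) := by noncomm_ring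
      have b1 : ‖(exp g - 1 - g - (1 / 2 : ℂ) • g ^ 2) * P‖
          ≤ (Real.exp ‖g‖ - 1 - ‖g‖ - ‖g‖ ^ 2 / 2) * Real.exp x :=
        (norm_mul_le _ _).trans (mul_le_mul e3 i0 (norm_nonneg _) ((norm_nonneg _).trans e3))
      have b2 : ‖g * (P - 1 - l.sum)‖ ≤ ‖g‖ * (Real.exp x - 1 - x) :=
        (norm_mul_le _ _).trans (by gcongr)
      have b3 : ‖((1 / 2 : ℂ) • g ^ 2) * (P - 1)‖ ≤ ‖g‖ ^ 2 / 2 * (Real.exp x - 1) :=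
        (norm_mul_le _ _).trans (by gcongr)
      rw [e, hx]
      refine (norm_add_le _ _).trans ((add_le_add_left (norm_add₃_le) _).trans ?_)
      nlinarith

end OrderedProducts

/-! ### Palindromic products of unitaries -/

section Palindrome

open NormedSpace

variable {n : Type} [Fintype n] [DecidableEq n]

lemma norm_one_matrix_le : ‖(1 : Matrix n n ℂ)‖ ≤ 1 := by
  rw [← Matrix.diagonal_one, Matrix.l2_opNorm_diagonal]
  exact (pi_norm_le_iff_of_nonneg zero_le_one).2 fun i => by simp

lemma exp_mem_unitary_of_skew {G : Matrix n n ℂ} (hG : Gᴴ = -G) :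
    exp G ∈ unitary (Matrix n n ℂ) := by
  let _ : NormedAlgebra ℚ (Matrix n n ℂ) := NormedAlgebra.restrictScalars ℚ ℂ _
  exact exp_mem_unitary_of_mem_skewAdjoint (skewAdjoint.mem_iff.2 hG)

lemma prod_exp_mem_unitary {l : List (Matrix n n ℂ)} (hl : ∀ G ∈ l, Gᴴ = -G) :
    (l.map exp).prod ∈ unitary (Matrix n n ℂ) := by
  refine Submonoid.list_prod_mem _ fun U hU => ?_
  obtain ⟨G, hG, rfl⟩ := List.mem_map.1 hU
  exact exp_mem_unitary_of_skew (hl G hG)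

/-- Time reversal: for a palindromic sequence of skew-Hermitian exponents, taking the adjoint of the
product reverses all signs. -/
lemma conjTranspose_prod_exp_palindrome {l : List (Matrix n n ℂ)} (hl : ∀ G ∈ l, Gᴴ = -G)
    (hp : l.reverse = l) :
    ((l.map exp).prod)ᴴ = ((l.map fun G => -G).map exp).prod := by
  rw [Matrix.conjTranspose_list_prod, ← List.map_reverse, ← List.map_reverse, hp, List.map_map,
    List.map_map]
  congr 1
  refine List.map_congr_left fun G hG => ?_
  simp only [Function.comp]
  rw [← Matrix.exp_conjTranspose, hl G hG]

/-- The skew-Hermitian part of a palindromic product is the sum of the exponents up to an error of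
third order: the second-order term is even, hence cancels. -/
lemma norm_skewPart_palindrome_sub_sum_le {l : List (Matrix n n ℂ)} (hl : ∀ G ∈ l, Gᴴ = -G)
    (hp : l.reverse = l) {x : ℝ} (hx : (l.map norm).sum ≤ x) (hx0 : 0 ≤ x) :
    ‖(1 / 2 : ℂ) • ((l.map exp).prod - ((l.map exp).prod)ᴴ) - l.sum‖ ≤ x ^ 3 * Real.exp x := by
  obtain ⟨-, -, -, h⟩ := norm_prod_exp_sub_le norm_one_matrix_le l
  obtain ⟨-, -, -, h'⟩ := norm_prod_exp_sub_le norm_one_matrix_le (l.map fun G => -G)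
  rw [← conjTranspose_prod_exp_palindrome hl hp, secondOrder_map_neg, ← List.sum_neg,
    List.map_map] at h'
  have hn : (l.map (norm ∘ fun G => -G)).sum = (l.map norm).sum := by
    congr 1
    refine List.map_congr_left fun G _ => by simp
  rw [hn] at h'
  set y := (l.map norm).sum
  have hy0 : 0 ≤ y := List.sum_nonneg fun r hr => by
    obtain ⟨G, -, rfl⟩ := List.mem_map.1 hr
    exact norm_nonneg _
  set V := (l.map exp).prod
  have e : (1 / 2 : ℂ) • (V - Vᴴ) - l.sum = (1 / 2 : ℂ) • ((V - 1 - l.sum - secondOrder l)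
      - (Vᴴ - 1 - -l.sum - secondOrder l)) := by module
  have h3 := exp_sub_three_terms_le_cube_mul_exp hy0
  rw [e, norm_smul]
  have h4 := norm_sub_le (V - 1 - l.sum - secondOrder l) (Vᴴ - 1 - -l.sum - secondOrder l)
  have h5 : y ^ 3 * Real.exp y ≤ x ^ 3 * Real.exp x := by gcongr
  rw [show ‖(1 / 2 : ℂ)‖ = 1 / 2 by norm_num]
  linarith

lemma norm_prod_exp_sub_one_le {l : List (Matrix n n ℂ)} {x : ℝ} (hx : (l.map norm).sum ≤ x) :
    ‖(l.map exp).prod - 1‖ ≤ x * Real.exp x := by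
  obtain ⟨-, h, -, -⟩ := norm_prod_exp_sub_le norm_one_matrix_le l
  refine h.trans (le_trans ?_ exp_sub_one_le_mul_exp)
  gcongr

/-- The Hermitian part of a unitary near the identity is quadratically close to the identity. -/
lemma norm_hermitianPart_sub_one_le {V : Matrix n n ℂ} (hV : V ∈ unitary (Matrix n n ℂ)) :
    ‖(1 / 2 : ℂ) • (V + Vᴴ) - 1‖ ≤ ‖V - 1‖ ^ 2 / 2 := by
  have hV' : Vᴴ * V = 1 := hV.1
  have e : (1 / 2 : ℂ) • (V + Vᴴ) - 1 = -((1 / 2 : ℂ) • ((V - 1)ᴴ * (V - 1))) := by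
    rw [Matrix.conjTranspose_sub, Matrix.conjTranspose_one, sub_mul, mul_sub, mul_sub, hV', one_mul,
      mul_one, one_mul]
    module
  rw [e, norm_neg, norm_smul, Matrix.l2_opNorm_conjTranspose_mul_self]
  rw [show ‖(1 / 2 : ℂ)‖ = 1 / 2 by norm_num]
  exact le_of_eq (by ring)

end Palindrome

/-! ### Kraus maps and dissipators in the Heisenberg picture -/

section Kraus

variable {d : Type} [Fintype d] [DecidableEq d]

lemma norm_one_kronecker_le {κ : Type} [Fintype κ] [DecidableEq κ] (Y : Matrix d d ℂ) :
    ‖(1 : Matrix κ κ ℂ) ⊗ₖ Y‖ ≤ ‖Y‖ := by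
  let φ : Matrix d d ℂ →⋆ₙₐ[ℂ] Matrix (κ × d) (κ × d) ℂ :=
    { toFun := fun Y => (1 : Matrix κ κ ℂ) ⊗ₖ Y
      map_smul' := fun c Y => Matrix.kronecker_smul _ _ _
      map_zero' := Matrix.kronecker_zero _
      map_add' := fun X Y => Matrix.kronecker_add _ _ _
      map_mul' := fun X Y => by rw [← Matrix.mul_kronecker_mul, one_mul]
      map_star' := fun X => by
        simp [Matrix.star_eq_conjTranspose, Matrix.conjTranspose_kronecker] }
  exact NonUnitalStarAlgHom.norm_apply_le φ Y

/-- A completely positive map is bounded by its value at the identity. -/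
lemma norm_sum_kraus_le {κ : Type} [Fintype κ] [DecidableEq κ] (K : κ → Matrix d d ℂ)
    (Y : Matrix d d ℂ) :
    ‖∑ i, (K i)ᴴ * Y * K i‖ ≤ ‖∑ i, (K i)ᴴ * K i‖ * ‖Y‖ := by
  -- the column `W` of the Kraus operators turns the map into a compression of `1 ⊗ Y`
  let W : Matrix (κ × d) d ℂ := Matrix.of fun p j => K p.1 p.2 j
  have hW : ∀ Y : Matrix d d ℂ, Wᴴ * ((1 : Matrix κ κ ℂ) ⊗ₖ Y) * W = ∑ i, (K i)ᴴ * Y * K i := by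
    intro Y
    ext a b
    simp only [Matrix.mul_apply, Matrix.sum_apply, Fintype.sum_prod_type, Matrix.kroneckerMap_apply,
      W, Matrix.of_apply, Matrix.conjTranspose_apply, Matrix.one_apply]
    refine Finset.sum_congr rfl fun i _ => Finset.sum_congr rfl fun j _ => ?_
    congr 1
    rw [Finset.sum_comm]
    refine Finset.sum_congr rfl fun k _ => ?_
    rw [Finset.sum_eq_single i] <;> simp +contextual
  have h1 : Wᴴ * W = ∑ i, (K i)ᴴ * K i := by
    have := hW 1
    simpa using this
  rw [← hW Y, ← h1, Matrix.l2_opNorm_conjTranspose_mul_self]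
  calc ‖Wᴴ * ((1 : Matrix κ κ ℂ) ⊗ₖ Y) * W‖ ≤ ‖Wᴴ‖ * ‖(1 : Matrix κ κ ℂ) ⊗ₖ Y‖ * ‖W‖ :=
        (Matrix.l2_opNorm_mul _ _).trans (by gcongr; exact Matrix.l2_opNorm_mul _ _)
    _ ≤ ‖W‖ * ‖Y‖ * ‖W‖ := by
        rw [Matrix.l2_opNorm_conjTranspose]
        gcongr
        exact norm_one_kronecker_le Y
    _ = _ := by ring

/-- The map `Y ↦ A * Y * B` as a continuous linear map. -/
noncomputable abbrev sandwich (A B : Matrix d d ℂ) : Matrix d d ℂ →L[ℂ] Matrix d d ℂ :=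
  ContinuousLinearMap.mulLeftRight ℂ (Matrix d d ℂ) A B

lemma norm_sandwich_le (A B : Matrix d d ℂ) : ‖sandwich A B‖ ≤ ‖A‖ * ‖B‖ :=
  ContinuousLinearMap.opNorm_mulLeftRight_apply_apply_le _ _ _ _

/-- The adjoint `Y ↦ Lᴴ Y L - (1/2) (Lᴴ L Y + Y Lᴴ L)` of the dissipator, acting on observables. -/
noncomputable def dissipatorDual (L : Matrix d d ℂ) : Matrix d d ℂ →L[ℂ] Matrix d d ℂ :=
  sandwich Lᴴ L - (1 / 2 : ℂ) • (sandwich (Lᴴ * L) 1 + sandwich 1 (Lᴴ * L))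

lemma dissipatorDual_apply (L Y : Matrix d d ℂ) :
    dissipatorDual L Y = Lᴴ * Y * L - (1 / 2 : ℂ) • (Lᴴ * L * Y + Y * (Lᴴ * L)) := by
  simp [dissipatorDual]

lemma dissipatorDual_smul (c : ℂ) (L : Matrix d d ℂ) :
    dissipatorDual (c • L) = ((‖c‖ ^ 2 : ℝ) : ℂ) • dissipatorDual L := by
  have hc : c * star c = ((‖c‖ ^ 2 : ℝ) : ℂ) := by
    rw [Complex.star_def, Complex.mul_conj, Complex.normSq_eq_norm_sq]
  ext1 Y
  simp only [dissipatorDual_apply, Matrix.conjTranspose_smul, Matrix.smul_mul, Matrix.mul_smul,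
    smul_smul, _root_.smul_apply, ← hc]
  module

/-- Bound for the sesquilinear form that polarizes `dissipatorDual`. -/
lemma norm_dissipator_form_le (A B : Matrix d d ℂ) :
    ‖sandwich Aᴴ B - (1 / 2 : ℂ) • (sandwich (Aᴴ * B) 1 + sandwich 1 (Aᴴ * B))‖
      ≤ 2 * (‖A‖ * ‖B‖) := by
  have hA : ‖Aᴴ‖ = ‖A‖ := Matrix.l2_opNorm_conjTranspose A
  have hAB : ‖Aᴴ * B‖ ≤ ‖A‖ * ‖B‖ := by rw [← hA]; exact norm_mul_le _ _
  have h1 : ‖sandwich Aᴴ B‖ ≤ ‖A‖ * ‖B‖ := by rw [← hA]; exact norm_sandwich_le _ _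
  have h2 : ‖sandwich (Aᴴ * B) 1‖ ≤ ‖A‖ * ‖B‖ :=
    (norm_sandwich_le _ _).trans ((mul_le_of_le_one_right (norm_nonneg _) norm_one_matrix_le).trans
      hAB)
  have h3 : ‖sandwich 1 (Aᴴ * B)‖ ≤ ‖A‖ * ‖B‖ :=
    (norm_sandwich_le _ _).trans ((mul_le_of_le_one_left (norm_nonneg _) norm_one_matrix_le).trans
      hAB)
  refine (norm_sub_le _ _).trans ?_
  rw [norm_smul, show ‖(1 / 2 : ℂ)‖ = 1 / 2 by norm_num]
  linarith [norm_add_le (sandwich (Aᴴ * B) 1) (sandwich 1 (Aᴴ * B))]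

lemma norm_dissipatorDual_le (L : Matrix d d ℂ) : ‖dissipatorDual L‖ ≤ 2 * ‖L‖ ^ 2 := by
  rw [sq]
  exact norm_dissipator_form_le L L

/-- The dissipator depends on the jump operator in a locally Lipschitz way. -/
lemma norm_dissipatorDual_sub_le (A B : Matrix d d ℂ) :
    ‖dissipatorDual A - dissipatorDual B‖ ≤ 2 * (‖A‖ + ‖B‖) * ‖A - B‖ := by
  have e : dissipatorDual A - dissipatorDual B
      = (sandwich Aᴴ (A - B)
          - (1 / 2 : ℂ) • (sandwich (Aᴴ * (A - B)) 1 + sandwich 1 (Aᴴ * (A - B))))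
        + (sandwich (A - B)ᴴ B
          - (1 / 2 : ℂ) • (sandwich ((A - B)ᴴ * B) 1 + sandwich 1 ((A - B)ᴴ * B))) := by
    ext1 Y
    simp only [dissipatorDual, _root_.sub_apply, _root_.add_apply,
      _root_.smul_apply, ContinuousLinearMap.mulLeftRight_apply,
      Matrix.conjTranspose_sub, sub_mul, mul_sub, mul_one, one_mul]
    module
  rw [e]
  have h1 := norm_dissipator_form_le A (A - B)
  have h2 := norm_dissipator_form_le (A - B) B
  refine (norm_add_le _ _).trans ?_
  linarith

/-- The commutator action `Y ↦ i [H, Y]` generating the Heisenberg evolution. -/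
noncomputable def hamiltonianDual (H : Matrix d d ℂ) : Matrix d d ℂ →L[ℂ] Matrix d d ℂ :=
  Complex.I • (sandwich H 1 - sandwich 1 H)

lemma hamiltonianDual_apply (H Y : Matrix d d ℂ) :
    hamiltonianDual H Y = Complex.I • (H * Y - Y * H) := by
  simp [hamiltonianDual]

/-- The commutator with a Hamiltonian acts on a dissipator as a derivation, so only the commutator
of the Hamiltonian with the jump operator enters. -/
lemma norm_hamiltonianDual_commutator_le {H : Matrix d d ℂ} (hH : H.IsHermitian)
    (L : Matrix d d ℂ) :
    ‖hamiltonianDual H * dissipatorDual L - dissipatorDual L * hamiltonianDual H‖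
      ≤ 4 * ‖L‖ * ‖H * L - L * H‖ := by
  set R := Complex.I • (H * L - L * H) with hR
  have hRn : ‖R‖ = ‖H * L - L * H‖ := by rw [hR, norm_smul]; simp
  have hRH : Rᴴ = Complex.I • (H * Lᴴ - Lᴴ * H) := by
    rw [hR, Matrix.conjTranspose_smul, Matrix.conjTranspose_sub, Matrix.conjTranspose_mul,
      Matrix.conjTranspose_mul, hH.eq, Complex.star_def, Complex.conj_I]
    module
  have e : hamiltonianDual H * dissipatorDual L - dissipatorDual L * hamiltonianDual H
      = (sandwich Lᴴ R - (1 / 2 : ℂ) • (sandwich (Lᴴ * R) 1 + sandwich 1 (Lᴴ * R)))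
        + (sandwich Rᴴ L - (1 / 2 : ℂ) • (sandwich (Rᴴ * L) 1 + sandwich 1 (Rᴴ * L))) := by
    ext1 Y
    rw [hRH, hR]
    simp only [dissipatorDual, hamiltonianDual, _root_.sub_apply,
      _root_.add_apply, mul_apply_eq_comp,
      _root_.smul_apply, ContinuousLinearMap.mulLeftRight_apply,
      sub_mul, mul_sub, add_mul, mul_add, mul_one, one_mul, Matrix.smul_mul, Matrix.mul_smul,
      smul_sub, smul_add, ← mul_assoc]
    module
  rw [e]
  have h1 := norm_dissipator_form_le L R
  have h2 := norm_dissipator_form_le R L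
  rw [hRn] at h1 h2
  refine (norm_add_le _ _).trans ?_
  linarith

end Kraus

/-! ### The Heisenberg semigroup -/

section Semigroup

open NormedSpace

lemma map_exp_of_map_pow {𝔸 𝔹 : Type*} [NormedRing 𝔸] [NormedAlgebra ℂ 𝔸] [CompleteSpace 𝔸]
    [NormedRing 𝔹] [NormedAlgebra ℂ 𝔹] [CompleteSpace 𝔹] (f : 𝔸 →L[ℂ] 𝔹) (x : 𝔸)
    (h : ∀ n : ℕ, f (x ^ n) = f x ^ n) : f (exp x) = exp (f x) := by
  have h1 := (exp_series_hasSum_exp' (𝕂 := ℂ) x).mapL f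
  have h2 := exp_series_hasSum_exp' (𝕂 := ℂ) (f x)
  refine h1.unique ?_
  convert h2 using 2 with n
  simp [h]

variable {d ι : Type} [Fintype d] [DecidableEq d] [Fintype ι]

lemma sandwich_mul_sandwich (A B C D : Matrix d d ℂ) :
    sandwich A B * sandwich C D = sandwich (A * C) (D * B) := by
  ext1 Y
  simp [mul_assoc]

lemma sandwich_one_one : sandwich (1 : Matrix d d ℂ) 1 = 1 := by
  ext1 Y
  simp

lemma exp_sandwich_left (X : Matrix d d ℂ) : exp (sandwich X 1) = sandwich (exp X) 1 := by
  refine (map_exp_of_map_pow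
    ((ContinuousLinearMap.mulLeftRight ℂ (Matrix d d ℂ)).flip 1) X fun n => ?_).symm
  simp only [ContinuousLinearMap.flip_apply]
  induction n with
  | zero => simpa using sandwich_one_one
  | succ n ih => rw [pow_succ, pow_succ, ← ih, sandwich_mul_sandwich, one_mul]

lemma exp_sandwich_right (X : Matrix d d ℂ) : exp (sandwich 1 X) = sandwich 1 (exp X) := by
  refine (map_exp_of_map_pow
    (ContinuousLinearMap.mulLeftRight ℂ (Matrix d d ℂ) 1) X fun n => ?_).symm
  induction n with
  | zero => simpa using sandwich_one_one
  | succ n ih => rw [pow_succ' X, pow_succ, ← ih, sandwich_mul_sandwich, one_mul]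

/-- The commutator action generates conjugation by the Hamiltonian evolution. -/
lemma exp_smul_hamiltonianDual (H : Matrix d d ℂ) (s : ℝ) :
    exp ((s : ℂ) • hamiltonianDual H) = sandwich (evolution H (-s)) (evolution H s) := by
  have e : (s : ℂ) • hamiltonianDual H
      = sandwich ((-(Complex.I * ((-s : ℝ) : ℂ))) • H) 1
        + sandwich 1 ((-(Complex.I * (s : ℂ))) • H) := by
    ext1 Y
    simp [hamiltonianDual]
    module
  let _ : NormedAlgebra ℚ (Matrix d d ℂ →L[ℂ] Matrix d d ℂ) :=
    NormedAlgebra.restrictScalars ℚ ℂ _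
  rw [e, exp_add_of_commute (𝔸 := Matrix d d ℂ →L[ℂ] Matrix d d ℂ), exp_sandwich_left,
    exp_sandwich_right, sandwich_mul_sandwich, mul_one, mul_one]
  · rfl
  · rw [Commute, SemiconjBy, sandwich_mul_sandwich, sandwich_mul_sandwich]
    simp

lemma conjTranspose_evolution {H : Matrix d d ℂ} (hH : H.IsHermitian) (s : ℝ) :
    (evolution H s)ᴴ = evolution H (-s) := by
  rw [evolution, evolution, ← Matrix.exp_conjTranspose, Matrix.conjTranspose_smul, hH.eq]
  congr 2
  simp

lemma evolution_add (H : Matrix d d ℂ) (s r : ℝ) :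
    evolution H (s + r) = evolution H s * evolution H r := by
  rw [evolution, evolution, evolution, ← Matrix.exp_add_of_commute]
  · congr 1
    push_cast
    module
  · exact ((Commute.refl H).smul_left _).smul_right _

lemma evolution_zero (H : Matrix d d ℂ) : evolution H 0 = 1 := by
  simp [evolution, exp_zero]

lemma evolution_mul_neg (H : Matrix d d ℂ) (s : ℝ) : evolution H s * evolution H (-s) = 1 := by
  rw [← evolution_add, add_neg_cancel, evolution_zero]

lemma evolution_neg_mul (H : Matrix d d ℂ) (s : ℝ) : evolution H (-s) * evolution H s = 1 := by
  rw [← evolution_add, neg_add_cancel, evolution_zero]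

lemma norm_evolution_le {H : Matrix d d ℂ} (hH : H.IsHermitian) (s : ℝ) : ‖evolution H s‖ ≤ 1 := by
  have h := Matrix.l2_opNorm_conjTranspose_mul_self (evolution H s)
  rw [conjTranspose_evolution hH, evolution_neg_mul] at h
  have h1 := norm_one_matrix_le (n := d)
  nlinarith [norm_nonneg (evolution H s)]

/-- The dissipative part of the Lindbladian in the Heisenberg picture. -/
noncomputable def dissipativeDual (L : ι → Matrix d d ℂ) (p : ι → ℝ) (γ : ℝ) :
    Matrix d d ℂ →L[ℂ] Matrix d d ℂ :=
  ∑ a, ((γ * p a : ℝ) : ℂ) • dissipatorDual (L a)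

/-- The Lindbladian in the Heisenberg picture. -/
noncomputable def lindbladianDual (H : Matrix d d ℂ) (L : ι → Matrix d d ℂ) (p : ι → ℝ) (γ : ℝ) :
    Matrix d d ℂ →L[ℂ] Matrix d d ℂ :=
  hamiltonianDual H + dissipativeDual L p γ

/-- The Euler step of the Heisenberg semigroup is completely positive and unital up to second
order, hence a contraction up to second order. -/
lemma norm_one_add_smul_lindbladianDual_le {H : Matrix d d ℂ} (hH : H.IsHermitian)
    (L : ι → Matrix d d ℂ) {p : ι → ℝ} (hp : ∀ a, 0 ≤ p a) {γ : ℝ} (hγ : 0 ≤ γ) :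
    ∃ C : ℝ, ∀ δ : ℝ, 0 ≤ δ → ‖1 + (δ : ℂ) • lindbladianDual H L p γ‖ ≤ 1 + C * δ ^ 2 := by
  classical
  set Q : Matrix d d ℂ := ∑ a, ((γ * p a : ℝ) : ℂ) • ((L a)ᴴ * L a) with hQ
  have hQH : Qᴴ = Q := by
    simp [hQ, Matrix.conjTranspose_sum, Matrix.conjTranspose_smul, Matrix.conjTranspose_mul]
  -- the effective non-Hermitian Hamiltonian
  set K : Matrix d d ℂ := (-Complex.I) • H - (1 / 2 : ℂ) • Q with hK
  have hKH : Kᴴ = Complex.I • H - (1 / 2 : ℂ) • Q := by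
    rw [hK, Matrix.conjTranspose_sub, Matrix.conjTranspose_smul, Matrix.conjTranspose_smul, hH.eq,
      hQH]
    simp
  refine ⟨2 * ‖K‖ ^ 2, fun δ hδ => ?_⟩
  refine ContinuousLinearMap.opNorm_le_bound _ (by positivity) fun Y => ?_
  let E : Option ι → Matrix d d ℂ := fun o =>
    o.elim (1 + (δ : ℂ) • K) fun a => ((√(δ * (γ * p a)) : ℝ) : ℂ) • L a
  have hE : ∀ Y : Matrix d d ℂ, ∑ o, (E o)ᴴ * Y * E o
      = Y + (δ : ℂ) • (lindbladianDual H L p γ Y) + (δ ^ 2 : ℂ) • (Kᴴ * Y * K) := by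
    intro Y
    rw [Fintype.sum_option]
    have h1 : ∀ a, (E (some a))ᴴ * Y * E (some a)
        = (δ : ℂ) • (((γ * p a : ℝ) : ℂ) • ((L a)ᴴ * Y * L a)) := fun a => by
      have h0 : 0 ≤ δ * (γ * p a) := mul_nonneg hδ (mul_nonneg hγ (hp a))
      simp only [E, Option.elim_some, Matrix.conjTranspose_smul, Matrix.smul_mul, Matrix.mul_smul,
        smul_smul, Complex.star_def, Complex.conj_ofReal, ← Complex.ofReal_mul,
        Real.mul_self_sqrt h0]
    have h2 : lindbladianDual H L p γ Y = Kᴴ * Y + Y * K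
        + ∑ a, ((γ * p a : ℝ) : ℂ) • ((L a)ᴴ * Y * L a) := by
      rw [lindbladianDual, _root_.add_apply, hamiltonianDual_apply, dissipativeDual,
        _root_.sum_apply]
      simp only [_root_.smul_apply, dissipatorDual_apply, smul_sub, Finset.sum_sub_distrib]
      have h3 : ∑ a, ((γ * p a : ℝ) : ℂ) • (1 / 2 : ℂ) • ((L a)ᴴ * L a * Y + Y * ((L a)ᴴ * L a))
          = (1 / 2 : ℂ) • (Q * Y + Y * Q) := by
        rw [hQ, Finset.sum_mul, Finset.mul_sum, ← Finset.sum_add_distrib, Finset.smul_sum]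
        refine Finset.sum_congr rfl fun a _ => ?_
        rw [Matrix.smul_mul, Matrix.mul_smul]
        module
      rw [h3, hKH, hK]
      simp only [sub_mul, mul_sub, Matrix.smul_mul, Matrix.mul_smul]
      module
    simp only [h1]
    rw [← Finset.smul_sum, h2]
    simp only [E, Option.elim_none, Matrix.conjTranspose_add, Matrix.conjTranspose_one,
      Matrix.conjTranspose_smul, Complex.star_def, Complex.conj_ofReal, add_mul, mul_add, one_mul,
      mul_one, Matrix.smul_mul, Matrix.mul_smul]
    module
  have hgen : lindbladianDual H L p γ 1 = 0 := by
    rw [lindbladianDual, _root_.add_apply, hamiltonianDual_apply, dissipativeDual,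
      _root_.sum_apply]
    simp only [_root_.smul_apply, dissipatorDual_apply, mul_one, one_mul, sub_self, smul_zero,
      zero_add]
    refine Finset.sum_eq_zero fun a _ => ?_
    module
  have hE1 : ∑ o, (E o)ᴴ * E o = 1 + (δ ^ 2 : ℂ) • (Kᴴ * K) := by
    simpa [hgen] using hE 1
  have hδ2 : ‖(δ ^ 2 : ℂ)‖ = δ ^ 2 := by simp
  have hKK : ‖(δ ^ 2 : ℂ) • (Kᴴ * K)‖ ≤ δ ^ 2 * ‖K‖ ^ 2 := by
    rw [norm_smul, hδ2, Matrix.l2_opNorm_conjTranspose_mul_self, sq ‖K‖]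
  have hKYK : ‖(δ ^ 2 : ℂ) • (Kᴴ * Y * K)‖ ≤ δ ^ 2 * ‖K‖ ^ 2 * ‖Y‖ := by
    rw [norm_smul, hδ2]
    have : ‖Kᴴ * Y * K‖ ≤ ‖K‖ * ‖Y‖ * ‖K‖ := by
      have h := norm_mul_le Kᴴ Y
      rw [Matrix.l2_opNorm_conjTranspose K] at h
      exact (norm_mul_le _ _).trans (by gcongr)
    calc δ ^ 2 * ‖Kᴴ * Y * K‖ ≤ δ ^ 2 * (‖K‖ * ‖Y‖ * ‖K‖) := by gcongr
      _ = _ := by ring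
  have hkr := norm_sum_kraus_le E Y
  rw [hE1, hE Y] at hkr
  have h1 : ‖1 + (δ ^ 2 : ℂ) • (Kᴴ * K)‖ ≤ 1 + δ ^ 2 * ‖K‖ ^ 2 :=
    (norm_add_le _ _).trans (add_le_add norm_one_matrix_le hKK)
  have e : (1 + (δ : ℂ) • lindbladianDual H L p γ) Y
      = (Y + (δ : ℂ) • (lindbladianDual H L p γ Y) + (δ ^ 2 : ℂ) • (Kᴴ * Y * K))
        - (δ ^ 2 : ℂ) • (Kᴴ * Y * K) := by
    simp
  rw [e]
  refine (norm_sub_le _ _).trans ?_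
  nlinarith [mul_le_mul_of_nonneg_right h1 (norm_nonneg Y)]

lemma norm_one_clm_le : ‖(1 : Matrix d d ℂ →L[ℂ] Matrix d d ℂ)‖ ≤ 1 :=
  ContinuousLinearMap.norm_id_le

/-- The Heisenberg semigroup is contractive in operator norm. -/
lemma norm_exp_lindbladianDual_le {H : Matrix d d ℂ} (hH : H.IsHermitian)
    (L : ι → Matrix d d ℂ) {p : ι → ℝ} (hp : ∀ a, 0 ≤ p a) {γ : ℝ} (hγ : 0 ≤ γ) {s : ℝ}
    (hs : 0 ≤ s) : ‖exp ((s : ℂ) • lindbladianDual H L p γ)‖ ≤ 1 := by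
  obtain ⟨C, hC⟩ := norm_one_add_smul_lindbladianDual_le hH L hp hγ
  exact norm_exp_smul_le_one_of_quadratic (𝔸 := Matrix d d ℂ →L[ℂ] Matrix d d ℂ) norm_one_clm_le _
    hC hs

/-- Hamiltonian evolution in the Heisenberg picture is contractive for both signs of the time. -/
lemma norm_exp_hamiltonianDual_le {H : Matrix d d ℂ} (hH : H.IsHermitian) (s : ℝ) :
    ‖exp ((s : ℂ) • hamiltonianDual H)‖ ≤ 1 := by
  rw [exp_smul_hamiltonianDual]
  exact (norm_sandwich_le _ _).trans
    (mul_le_one₀ (norm_evolution_le hH _) (norm_nonneg _) (norm_evolution_le hH _))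

end Semigroup

/-! ### One dissipative step -/

section Blocks

variable {d : Type}

/-- The block `⟨k| X |l⟩` of an operator on ancilla and system. -/
def block (k l : Fin 2) (X : Matrix (Fin 2 × d) (Fin 2 × d) ℂ) : Matrix d d ℂ :=
  X.submatrix (Prod.mk k) (Prod.mk l)

lemma block_mul [Fintype d] (k l : Fin 2) (X Y : Matrix (Fin 2 × d) (Fin 2 × d) ℂ) :
    block k l (X * Y) = block k 0 X * block 0 l Y + block k 1 X * block 1 l Y := by
  ext i j
  simp [block, Matrix.mul_apply, Fintype.sum_prod_type]

lemma block_conjTranspose (k l : Fin 2) (X : Matrix (Fin 2 × d) (Fin 2 × d) ℂ) :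
    block k l Xᴴ = (block l k X)ᴴ := rfl

lemma block_add (k l : Fin 2) (X Y : Matrix (Fin 2 × d) (Fin 2 × d) ℂ) :
    block k l (X + Y) = block k l X + block k l Y := rfl

lemma block_sub (k l : Fin 2) (X Y : Matrix (Fin 2 × d) (Fin 2 × d) ℂ) :
    block k l (X - Y) = block k l X - block k l Y := rfl

lemma block_smul (k l : Fin 2) (c : ℂ) (X : Matrix (Fin 2 × d) (Fin 2 × d) ℂ) :
    block k l (c • X) = c • block k l X := rfl

lemma block_zero (k l : Fin 2) : block k l (0 : Matrix (Fin 2 × d) (Fin 2 × d) ℂ) = 0 := rfl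

lemma block_one [DecidableEq d] (k l : Fin 2) :
    block k l (1 : Matrix (Fin 2 × d) (Fin 2 × d) ℂ) = if k = l then 1 else 0 := by
  ext i j
  by_cases h : k = l <;> simp [block, Matrix.one_apply, h]

/-- The exponent of the coupling gate. -/
noncomputable def couplingExponent (A : Matrix d d ℂ) (w : ℂ) :
    Matrix (Fin 2 × d) (Fin 2 × d) ℂ :=
  (-Complex.I) • (((w.re : ℂ) • pauliX + (w.im : ℂ) • pauliY) ⊗ₖ A)

lemma pauli_combination (w : ℂ) :
    (w.re : ℂ) • pauliX + (w.im : ℂ) • pauliY = !![0, star w; w, 0] := by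
  have h1 : (w.re : ℂ) + (w.im : ℂ) * Complex.I = w := Complex.re_add_im w
  have h2 : (w.re : ℂ) - (w.im : ℂ) * Complex.I = star w := by
    apply Complex.ext <;> simp
  ext i j
  fin_cases i <;> fin_cases j <;> simp [pauliX, pauliY, h1, ← h2, sub_eq_add_neg]

lemma couplingExponent_eq (A : Matrix d d ℂ) (w : ℂ) :
    couplingExponent A w = (-Complex.I) • (!![0, star w; w, 0] ⊗ₖ A) := by
  rw [couplingExponent, pauli_combination]

lemma conjTranspose_couplingExponent {A : Matrix d d ℂ} (hA : A.IsHermitian) (w : ℂ) :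
    (couplingExponent A w)ᴴ = -couplingExponent A w := by
  rw [couplingExponent_eq, Matrix.conjTranspose_smul, Matrix.conjTranspose_kronecker, hA.eq]
  have : (!![0, star w; w, 0] : Matrix (Fin 2) (Fin 2) ℂ)ᴴ = !![0, star w; w, 0] := by
    ext i j
    fin_cases i <;> fin_cases j <;> simp
  rw [this]
  simp

lemma block_couplingExponent (A : Matrix d d ℂ) (w : ℂ) :
    block 1 0 (couplingExponent A w) = (-Complex.I * w) • A := by
  ext i j
  rw [couplingExponent_eq]
  simp [block, Matrix.kroneckerMap_apply, mul_assoc]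

end Blocks

section Channel

open NormedSpace

variable {d : Type} [Fintype d] [DecidableEq d]

/-- A two-element Kraus map whose no-jump operator `c` is Hermitian is determined up to fourth order
by its jump operator: `c = √(1 - bᴴ b)` is `1 - bᴴ b / 2` up to `(c - 1)² / 2`. -/
lemma norm_kraus_pair_sub_le {c b : Matrix d d ℂ} (hc : cᴴ = c) (hcb : c * c + bᴴ * b = 1)
    (l Y : Matrix d d ℂ) :
    ‖cᴴ * Y * c + bᴴ * Y * b - Y - dissipatorDual l Y‖
      ≤ (2 * ‖c - 1‖ ^ 2 + 2 * (‖b‖ + ‖l‖) * ‖b - l‖) * ‖Y‖ := by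
  set e := c - 1 with he
  have hce : c = 1 + e := by rw [he]; abel
  have hbb : bᴴ * b = -(e + e + e * e) := by
    rw [eq_sub_of_add_eq' hcb, hce]
    noncomm_ring
  have h1 : cᴴ * Y * c + bᴴ * Y * b - Y - dissipatorDual l Y
      = (e * Y * e - (1 / 2 : ℂ) • (e * e * Y + Y * (e * e)))
        + (dissipatorDual b - dissipatorDual l) Y := by
    rw [_root_.sub_apply, dissipatorDual_apply b, hbb, hc, hce]
    simp only [mul_add, add_mul, mul_one, one_mul, mul_neg, neg_mul]
    module
  have h2 : ‖e * Y * e‖ ≤ ‖e‖ ^ 2 * ‖Y‖ :=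
    (norm_mul₃_le).trans (le_of_eq (by ring))
  have h3 : ‖e * e * Y‖ ≤ ‖e‖ ^ 2 * ‖Y‖ := (norm_mul₃_le).trans (le_of_eq (by ring))
  have h4 : ‖Y * (e * e)‖ ≤ ‖e‖ ^ 2 * ‖Y‖ := by
    rw [← mul_assoc]
    exact (norm_mul₃_le).trans (le_of_eq (by ring))
  have h5 : ‖(dissipatorDual b - dissipatorDual l) Y‖ ≤ 2 * (‖b‖ + ‖l‖) * ‖b - l‖ * ‖Y‖ :=
    (ContinuousLinearMap.le_opNorm _ _).trans (by gcongr; exact norm_dissipatorDual_sub_le b l)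
  have h6 : ‖e * Y * e - (1 / 2 : ℂ) • (e * e * Y + Y * (e * e))‖ ≤ 2 * ‖e‖ ^ 2 * ‖Y‖ := by
    refine (norm_sub_le _ _).trans ?_
    rw [norm_smul, show ‖(1 / 2 : ℂ)‖ = 1 / 2 by norm_num]
    linarith [norm_add_le (e * e * Y) (Y * (e * e))]
  rw [h1]
  refine (norm_add_le _ _).trans ?_
  linarith

lemma norm_block_le (k l : Fin 2) (X : Matrix (Fin 2 × d) (Fin 2 × d) ℂ) :
    ‖block k l X‖ ≤ ‖X‖ := by
  -- the block is a compression of `X` by the isometries `v ↦ |k⟩ ⊗ v`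
  let J : Fin 2 → Matrix (Fin 2 × d) d ℂ := fun k =>
    Matrix.of fun q j => if q = (k, j) then 1 else 0
  have hJ1 : ∀ k, (J k)ᴴ * J k = 1 := fun k => by
    ext i j
    simp [J, Matrix.mul_apply, Matrix.one_apply, apply_ite star, eq_comm]
  have hJ : ∀ k, ‖J k‖ ≤ 1 := fun k => by
    have h := Matrix.l2_opNorm_conjTranspose_mul_self (J k)
    rw [hJ1] at h
    have h1 := norm_one_matrix_le (n := d)
    nlinarith [norm_nonneg (J k)]
  have hX : block k l X = (J k)ᴴ * X * J l := by
    ext i j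
    simp [J, Matrix.mul_apply, block, apply_ite star]
  have h1 : ‖(J k)ᴴ‖ ≤ 1 := by
    rw [Matrix.l2_opNorm_conjTranspose]
    exact hJ k
  rw [hX]
  calc ‖(J k)ᴴ * X * J l‖ ≤ ‖(J k)ᴴ‖ * ‖X‖ * ‖J l‖ :=
        (Matrix.l2_opNorm_mul _ _).trans (by gcongr; exact Matrix.l2_opNorm_mul _ _)
    _ ≤ 1 * ‖X‖ * 1 := by gcongr; exact hJ l
    _ = ‖X‖ := by ring

lemma exp_couplingExponent (A : Matrix d d ℂ) (w : ℂ) :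
    exp (couplingExponent A w) = coupling A w := rfl

lemma norm_couplingExponent_le (A : Matrix d d ℂ) (w : ℂ) :
    ‖couplingExponent A w‖ ≤ ‖w‖ * ‖A‖ := by
  have h := Matrix.l2_opNorm_conjTranspose_mul_self (!![0, star w; w, 0] ⊗ₖ A)
  have e : (!![0, star w; w, 0] : Matrix (Fin 2) (Fin 2) ℂ)ᴴ * !![0, star w; w, 0]
      = ((‖w‖ ^ 2 : ℝ) : ℂ) • (1 : Matrix (Fin 2) (Fin 2) ℂ) := by
    have hw : w * star w = ((‖w‖ ^ 2 : ℝ) : ℂ) := by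
      rw [Complex.star_def, Complex.mul_conj, Complex.normSq_eq_norm_sq]
    rw [← hw]
    ext i j
    fin_cases i <;> fin_cases j <;> simp [Matrix.mul_apply, mul_comm]
  rw [Matrix.conjTranspose_kronecker, ← Matrix.mul_kronecker_mul, e, Matrix.smul_kronecker,
    norm_smul, Complex.norm_real, Real.norm_of_nonneg (sq_nonneg _)] at h
  have h2 := norm_one_kronecker_le (κ := Fin 2) (Aᴴ * A)
  rw [Matrix.l2_opNorm_conjTranspose_mul_self] at h2
  rw [couplingExponent_eq, norm_smul, norm_neg, Complex.norm_I, one_mul]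
  refine abs_le_of_sq_le_sq' ?_ (by positivity) |>.2
  nlinarith [mul_le_mul_of_nonneg_left h2 (sq_nonneg ‖w‖)]

/-- The Pauli operator `Z` on the ancilla. -/
def ancillaParity : Matrix (Fin 2 × d) (Fin 2 × d) ℂ :=
  Matrix.diagonal fun q => if q.1 = 0 then 1 else -1

lemma ancillaParity_mul_self :
    (ancillaParity : Matrix (Fin 2 × d) (Fin 2 × d) ℂ) * ancillaParity = 1 := by
  rw [ancillaParity, Matrix.diagonal_mul_diagonal, ← Matrix.diagonal_one]
  congr 1
  ext ⟨k, i⟩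
  fin_cases k <;> simp

lemma ancillaParity_conj_apply (X : Matrix (Fin 2 × d) (Fin 2 × d) ℂ) (q r : Fin 2 × d) :
    (ancillaParity * X * ancillaParity : Matrix (Fin 2 × d) (Fin 2 × d) ℂ) q r
      = (if q.1 = 0 then 1 else -1) * X q r * (if r.1 = 0 then 1 else -1) := by
  rw [ancillaParity, Matrix.mul_diagonal, Matrix.diagonal_mul]

lemma ancillaParity_conj_couplingExponent (A : Matrix d d ℂ) (w : ℂ) :
    ancillaParity * couplingExponent A w * ancillaParity = -couplingExponent A w := by
  ext ⟨k, i⟩ ⟨l, j⟩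
  rw [ancillaParity_conj_apply, couplingExponent_eq]
  fin_cases k <;> fin_cases l <;> simp [Matrix.kroneckerMap_apply]

lemma block_parity_even (X : Matrix (Fin 2 × d) (Fin 2 × d) ℂ) :
    block 0 0 (ancillaParity * X * ancillaParity) = block 0 0 X := by
  ext i j
  simp [block, ancillaParity_conj_apply]

lemma block_parity_odd (X : Matrix (Fin 2 × d) (Fin 2 × d) ℂ) :
    block 1 0 (ancillaParity * X * ancillaParity) = -block 1 0 X := by
  ext i j
  simp [block, ancillaParity_conj_apply]

/-- Conjugation by the ancilla parity reverses the sign of every coupling, just as the adjoint of a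
palindromic product does. -/
lemma ancillaParity_conj_prod {l : List (Matrix (Fin 2 × d) (Fin 2 × d) ℂ)}
    (hl : ∀ G ∈ l, ancillaParity * G * ancillaParity = -G) :
    ancillaParity * (l.map exp).prod * ancillaParity = ((l.map fun G => -G).map exp).prod := by
  let u : (Matrix (Fin 2 × d) (Fin 2 × d) ℂ)ˣ :=
    ⟨ancillaParity, ancillaParity, ancillaParity_mul_self, ancillaParity_mul_self⟩
  induction l with
  | nil => simp [ancillaParity_mul_self]
  | cons G l ih =>
    have h1 : ancillaParity * exp G * ancillaParity = exp (-G) := by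
      rw [← hl G List.mem_cons_self]
      exact (Matrix.exp_units_conj u G).symm
    have h2 := ih fun G' hG' => hl G' (List.mem_cons_of_mem _ hG')
    simp only [List.map_cons, List.prod_cons]
    rw [← h1, ← h2]
    simp only [mul_assoc]
    rw [← mul_assoc ancillaParity ancillaParity, ancillaParity_mul_self, one_mul]

/-- The Heisenberg picture of the channel obtained by attaching the ancilla in `|0⟩`, applying `V`
and discarding the ancilla. -/
noncomputable def dilationDual (V : Matrix (Fin 2 × d) (Fin 2 × d) ℂ) :
    Matrix d d ℂ →L[ℂ] Matrix d d ℂ :=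
  sandwich (block 0 0 V)ᴴ (block 0 0 V) + sandwich (block 1 0 V)ᴴ (block 1 0 V)

lemma dilationDual_apply (V : Matrix (Fin 2 × d) (Fin 2 × d) ℂ) (Y : Matrix d d ℂ) :
    dilationDual V Y
      = (block 0 0 V)ᴴ * Y * block 0 0 V + (block 1 0 V)ᴴ * Y * block 1 0 V := by
  simp [dilationDual]

lemma block_isometry {V : Matrix (Fin 2 × d) (Fin 2 × d) ℂ}
    (hV : V ∈ unitary (Matrix (Fin 2 × d) (Fin 2 × d) ℂ)) :
    (block 0 0 V)ᴴ * block 0 0 V + (block 1 0 V)ᴴ * block 1 0 V = 1 := by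
  have hV' : Vᴴ * V = 1 := hV.1
  rw [← block_conjTranspose, ← block_conjTranspose, ← block_mul, hV', block_one, if_pos rfl]

lemma norm_dilationDual_le {V : Matrix (Fin 2 × d) (Fin 2 × d) ℂ}
    (hV : V ∈ unitary (Matrix (Fin 2 × d) (Fin 2 × d) ℂ)) : ‖dilationDual V‖ ≤ 1 := by
  refine ContinuousLinearMap.opNorm_le_bound _ zero_le_one fun Y => ?_
  have h := norm_sum_kraus_le (κ := Fin 2) (fun k => block k 0 V) Y
  rw [Fin.sum_univ_two, Fin.sum_univ_two, block_isometry hV] at h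
  rw [dilationDual_apply]
  exact h.trans (by gcongr; exact norm_one_matrix_le)

/-- A palindromic product of weak couplings, followed by discarding the ancilla, is a step of the
Lindblad semigroup whose jump operator is the sum of the coupled operators, with an error of fourth
order in the total coupling strength `x`. -/
lemma norm_dilationDual_palindrome_sub_le {l : List (Matrix d d ℂ × ℂ)}
    (hl : ∀ q ∈ l, q.1.IsHermitian) (hp : l.reverse = l) {x : ℝ} (hx0 : 0 ≤ x)
    (hx : (l.map fun q => ‖q.2‖ * ‖q.1‖).sum ≤ x) :
    ‖dilationDual ((l.map fun q => coupling q.1 q.2).prod) - 1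
        - dissipatorDual ((l.map fun q => q.2 • q.1).sum)‖
      ≤ x ^ 4 * (5 * Real.exp x ^ 4 + 2 * x ^ 2 * Real.exp x ^ 2) := by
  set gs : List (Matrix (Fin 2 × d) (Fin 2 × d) ℂ) :=
    l.map fun q => couplingExponent q.1 q.2 with hgs
  have hskew : ∀ G ∈ gs, Gᴴ = -G := fun G hG => by
    obtain ⟨q, hq, rfl⟩ := List.mem_map.1 hG
    exact conjTranspose_couplingExponent (hl q hq) _
  have hpar : ∀ G ∈ gs, ancillaParity * G * ancillaParity = -G := fun G hG => by
    obtain ⟨q, hq, rfl⟩ := List.mem_map.1 hG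
    exact ancillaParity_conj_couplingExponent _ _
  have hpal : gs.reverse = gs := by rw [hgs, ← List.map_reverse, hp]
  have hgx : (gs.map norm).sum ≤ x := by
    refine le_trans ?_ hx
    rw [hgs, List.map_map]
    exact List.sum_le_sum fun q _ => norm_couplingExponent_le q.1 q.2
  have hVeq : (l.map fun q => coupling q.1 q.2).prod = (gs.map exp).prod := by
    rw [hgs, List.map_map]
    rfl
  rw [hVeq]
  set V := (gs.map exp).prod with hVdef
  have hV : V ∈ unitary (Matrix (Fin 2 × d) (Fin 2 × d) ℂ) := prod_exp_mem_unitary hskew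
  have hrev : ancillaParity * V * ancillaParity = Vᴴ := by
    rw [hVdef, conjTranspose_prod_exp_palindrome hskew hpal, ancillaParity_conj_prod hpar]
  set c : Matrix d d ℂ := block 0 0 V with hc
  set b : Matrix d d ℂ := block 1 0 V with hb
  have hcH : cᴴ = c := by
    rw [hc, ← block_conjTranspose, ← hrev, block_parity_even]
  have hbV : block 1 0 Vᴴ = -b := by rw [← hrev, block_parity_odd]
  have hone : c * c + bᴴ * b = 1 := by
    have := block_isometry hV
    rwa [← hc, ← hb, hcH] at this
  have hc1 : ‖c - 1‖ ≤ (x * Real.exp x) ^ 2 / 2 := by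
    have e : c - 1 = block 0 0 ((1 / 2 : ℂ) • (V + Vᴴ) - 1) := by
      rw [block_sub, block_smul, block_add, block_one, if_pos rfl, block_conjTranspose, ← hc, hcH]
      module
    rw [e]
    refine (norm_block_le _ _ _).trans ((norm_hermitianPart_sub_one_le hV).trans ?_)
    have := norm_prod_exp_sub_one_le hgx
    gcongr
  set s : Matrix d d ℂ := (l.map fun q => q.2 • q.1).sum with hs
  -- the block of the summed exponents carries the jump operator, with a phase
  have hsum : block 1 0 gs.sum = (-Complex.I) • s := by
    have : ∀ m : List (Matrix d d ℂ × ℂ), block 1 0 (m.map fun q => couplingExponent q.1 q.2).sum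
        = (-Complex.I) • (m.map fun q => q.2 • q.1).sum := fun m => by
      induction m with
      | nil => simp [block_zero]
      | cons q m ih =>
        simp only [List.map_cons, List.sum_cons, block_add, ih, block_couplingExponent, smul_add,
          smul_smul]
    exact this l
  have hbl : ‖b - (-Complex.I) • s‖ ≤ x ^ 3 * Real.exp x := by
    have e : b - (-Complex.I) • s = block 1 0 ((1 / 2 : ℂ) • (V - Vᴴ) - gs.sum) := by
      rw [block_sub, hsum, block_smul, block_sub, hbV, ← hb]
      module
    rw [e]
    exact (norm_block_le _ _ _).trans (norm_skewPart_palindrome_sub_sum_le hskew hpal hgx hx0)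
  have hsn : ‖(-Complex.I) • s‖ ≤ x := by
    rw [← hsum]
    refine (norm_block_le _ _ _).trans (le_trans ?_ hgx)
    exact List.le_sum_of_subadditive norm norm_zero.le norm_add_le gs
  have hbn : ‖b‖ ≤ x + x ^ 3 * Real.exp x := by
    have : b = (-Complex.I) • s + (b - (-Complex.I) • s) := by abel
    rw [this]
    exact (norm_add_le _ _).trans (add_le_add hsn hbl)
  have hD : dissipatorDual s = dissipatorDual ((-Complex.I) • s) := by
    rw [dissipatorDual_smul]
    simp
  refine ContinuousLinearMap.opNorm_le_bound _ (by positivity) fun Y => ?_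
  have h := norm_kraus_pair_sub_le hcH hone ((-Complex.I) • s) Y
  rw [← hD] at h
  have e : (dilationDual V - 1 - dissipatorDual s) Y
      = cᴴ * Y * c + bᴴ * Y * b - Y - dissipatorDual s Y := by
    rw [_root_.sub_apply, _root_.sub_apply, dilationDual_apply]
    rfl
  rw [e]
  refine h.trans (mul_le_mul_of_nonneg_right ?_ (norm_nonneg Y))
  have hE : 1 ≤ Real.exp x := Real.one_le_exp hx0
  calc 2 * ‖c - 1‖ ^ 2 + 2 * (‖b‖ + ‖(-Complex.I) • s‖) * ‖b - (-Complex.I) • s‖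
      ≤ 2 * ((x * Real.exp x) ^ 2 / 2) ^ 2
        + 2 * ((x + x ^ 3 * Real.exp x) + x) * (x ^ 3 * Real.exp x) := by gcongr
    _ = x ^ 4 * (Real.exp x ^ 4 / 2 + 4 * Real.exp x + 2 * x ^ 2 * Real.exp x ^ 2) := by ring
    _ ≤ x ^ 4 * (5 * Real.exp x ^ 4 + 2 * x ^ 2 * Real.exp x ^ 2) := by
        have : Real.exp x ≤ Real.exp x ^ 4 := le_self_pow₀ hE (by norm_num)
        have : 0 ≤ Real.exp x ^ 4 := by positivity
        gcongr
        linarith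

end Channel

/-! ### Trace duality between the Schrödinger and the Heisenberg picture -/

section Duality

open NormedSpace

variable {d : Type} [Fintype d]

/-- `Ψ` is the adjoint of `Φ` with respect to the trace pairing. -/
def IsTraceDual (Φ Ψ : Matrix d d ℂ →L[ℂ] Matrix d d ℂ) : Prop :=
  ∀ Y X : Matrix d d ℂ, (Y * Φ X).trace = (Ψ Y * X).trace

lemma IsTraceDual.add {Φ Ψ Φ' Ψ' : Matrix d d ℂ →L[ℂ] Matrix d d ℂ} (h : IsTraceDual Φ Ψ)
    (h' : IsTraceDual Φ' Ψ') : IsTraceDual (Φ + Φ') (Ψ + Ψ') := by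
  intro Y X
  simp [mul_add, add_mul, h Y X, h' Y X]

lemma IsTraceDual.smul {Φ Ψ : Matrix d d ℂ →L[ℂ] Matrix d d ℂ} (h : IsTraceDual Φ Ψ) (c : ℂ) :
    IsTraceDual (c • Φ) (c • Ψ) := by
  intro Y X
  simp [h Y X]

lemma IsTraceDual.sub {Φ Ψ Φ' Ψ' : Matrix d d ℂ →L[ℂ] Matrix d d ℂ} (h : IsTraceDual Φ Ψ)
    (h' : IsTraceDual Φ' Ψ') : IsTraceDual (Φ - Φ') (Ψ - Ψ') := by
  intro Y X
  simp [mul_sub, sub_mul, h Y X, h' Y X]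

lemma IsTraceDual.sum {ι : Type} (s : Finset ι) {Φ Ψ : ι → Matrix d d ℂ →L[ℂ] Matrix d d ℂ}
    (h : ∀ a, IsTraceDual (Φ a) (Ψ a)) : IsTraceDual (∑ a ∈ s, Φ a) (∑ a ∈ s, Ψ a) := by
  intro Y X
  simp only [_root_.sum_apply, Finset.mul_sum, Finset.sum_mul, Matrix.trace_sum, h _ Y X]

/-- Taking adjoints reverses composition. -/
lemma IsTraceDual.mul {Φ Ψ Φ' Ψ' : Matrix d d ℂ →L[ℂ] Matrix d d ℂ} (h : IsTraceDual Φ Ψ)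
    (h' : IsTraceDual Φ' Ψ') : IsTraceDual (Φ * Φ') (Ψ' * Ψ) := by
  intro Y X
  rw [mul_apply_eq_comp, mul_apply_eq_comp, h, h']

lemma IsTraceDual.pow {Φ Ψ : Matrix d d ℂ →L[ℂ] Matrix d d ℂ} (h : IsTraceDual Φ Ψ) (n : ℕ) :
    IsTraceDual (Φ ^ n) (Ψ ^ n) := by
  induction n with
  | zero => intro Y X; simp
  | succ n ih => rw [pow_succ, pow_succ']; exact ih.mul h

variable [DecidableEq d]

lemma isTraceDual_sandwich (A B : Matrix d d ℂ) : IsTraceDual (sandwich A B) (sandwich B A) := by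
  intro Y X
  simp only [ContinuousLinearMap.mulLeftRight_apply, ← mul_assoc]
  rw [Matrix.trace_mul_comm, ← mul_assoc, ← mul_assoc]

lemma IsTraceDual.exp {Φ Ψ : Matrix d d ℂ →L[ℂ] Matrix d d ℂ} (h : IsTraceDual Φ Ψ) :
    IsTraceDual (NormedSpace.exp Φ) (NormedSpace.exp Ψ) := by
  intro Y X
  let tr : Matrix d d ℂ →L[ℂ] ℂ := LinearMap.toContinuousLinearMap (Matrix.traceLinearMap d ℂ ℂ)
  have h1 : HasSum (fun n : ℕ => ((n.factorial : ℂ)⁻¹) • Φ ^ n) (NormedSpace.exp Φ) :=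
    exp_series_hasSum_exp' (𝕂 := ℂ) (𝔸 := Matrix d d ℂ →L[ℂ] Matrix d d ℂ) Φ
  have h2 : HasSum (fun n : ℕ => ((n.factorial : ℂ)⁻¹) • Ψ ^ n) (NormedSpace.exp Ψ) :=
    exp_series_hasSum_exp' (𝕂 := ℂ) (𝔸 := Matrix d d ℂ →L[ℂ] Matrix d d ℂ) Ψ
  have h3 := h1.mapL (tr ∘L ContinuousLinearMap.mul ℂ (Matrix d d ℂ) Y ∘L
    ContinuousLinearMap.apply ℂ (Matrix d d ℂ) X)
  have h4 := h2.mapL (tr ∘L (ContinuousLinearMap.mul ℂ (Matrix d d ℂ)).flip X ∘L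
    ContinuousLinearMap.apply ℂ (Matrix d d ℂ) Y)
  refine h3.unique ?_
  have h5 : (fun n : ℕ => (Y * (((n.factorial : ℂ)⁻¹) • Φ ^ n) X).trace)
      = fun n : ℕ => ((((n.factorial : ℂ)⁻¹) • Ψ ^ n) Y * X).trace :=
    funext fun n => ((h.pow n).smul _) Y X
  exact h5 ▸ h4

lemma isTraceDual_lindbladian {ι : Type} [Fintype ι] (H : Matrix d d ℂ) (L : ι → Matrix d d ℂ)
    {p : ι → ℝ} (hp : ∑ a, p a = 1) (γ : ℝ) :
    IsTraceDual (lindbladian H L p γ) (lindbladianDual H L p γ) := by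
  have e : lindbladian H L p γ = (-Complex.I) • (sandwich H 1 - sandwich 1 H)
      + ∑ a, ((γ * p a : ℝ) : ℂ) • (sandwich (L a) (L a)ᴴ
        - (1 / 2 : ℂ) • (sandwich ((L a)ᴴ * L a) 1 + sandwich 1 ((L a)ᴴ * L a))) := by
    ext1 X
    have hp' : ∑ a, (p a : ℂ) = 1 := by exact_mod_cast hp
    have hX : lindbladian H L p γ X = ∑ a, (p a : ℂ) •
        ((-Complex.I) • (H * X - X * H) + (γ : ℂ) • dissipator (L a) X) := rfl
    rw [hX]
    simp only [smul_add, Finset.sum_add_distrib, ← Finset.sum_smul, hp', one_smul]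
    simp only [_root_.add_apply, _root_.smul_apply, _root_.sub_apply, _root_.sum_apply,
      ContinuousLinearMap.mulLeftRight_apply, one_mul, mul_one, smul_smul]
    congr 1
    refine Finset.sum_congr rfl fun a _ => ?_
    rw [← Complex.ofReal_mul, mul_comm γ, dissipator, smul_add]
  have e' : hamiltonianDual H = (-Complex.I) • (sandwich 1 H - sandwich H 1) := by
    rw [hamiltonianDual]
    module
  rw [e, lindbladianDual, e', dissipativeDual]
  refine (((isTraceDual_sandwich _ _).sub (isTraceDual_sandwich _ _)).smul _).add
    (IsTraceDual.sum _ fun a => IsTraceDual.smul ?_ _)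
  have h := (isTraceDual_sandwich ((L a)ᴴ * L a) 1).add (isTraceDual_sandwich 1 ((L a)ᴴ * L a))
  rw [add_comm (sandwich 1 ((L a)ᴴ * L a)) (sandwich ((L a)ᴴ * L a) 1)] at h
  exact (isTraceDual_sandwich _ _).sub (h.smul _)

end Duality

/-! ### Semantics of the protocol -/

section Semantics

variable {d ι : Type}

lemma traceAnc_eq (X : Matrix (Fin 2 × d) (Fin 2 × d) ℂ) :
    traceAnc X = block 0 0 X + block 1 1 X := by
  ext i j
  simp [traceAnc, block]

lemma traceAnc_anc0 (ρ : Matrix d d ℂ) : traceAnc (anc0 ⊗ₖ ρ) = ρ := by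
  ext i j
  simp [traceAnc, anc0]

/-- Averaging independent labels turns the sequence of steps into a power of the mean step. -/
lemma sum_prod_smul_foldl [Fintype ι] (Φ : ι → Matrix d d ℂ →L[ℂ] Matrix d d ℂ) (p : ι → ℝ)
    (M : ℕ) (ρ : Matrix d d ℂ) :
    ∑ a : Fin M → ι, ((∏ i, p (a i) : ℝ) : ℂ) • (List.ofFn a).foldl (fun X a => Φ a X) ρ
      = ((∑ a, (p a : ℂ) • Φ a) ^ M) ρ := by
  induction M generalizing ρ with
  | zero => simp
  | succ M ih =>
    rw [← (Fin.consEquiv fun _ : Fin (M + 1) => ι).sum_comp, Fintype.sum_prod_type]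
    have h : ∀ a : ι, ∑ b : Fin M → ι,
        ((∏ i, p ((Fin.consEquiv fun _ : Fin (M + 1) => ι) (a, b) i) : ℝ) : ℂ) •
          (List.ofFn ((Fin.consEquiv fun _ : Fin (M + 1) => ι) (a, b))).foldl
            (fun X a => Φ a X) ρ
        = (p a : ℂ) • ((∑ a, (p a : ℂ) • Φ a) ^ M) (Φ a ρ) := fun a => by
      rw [← ih, Finset.smul_sum]
      refine Finset.sum_congr rfl fun b _ => ?_
      simp [Fin.consEquiv, Fin.prod_univ_succ, List.ofFn_succ, smul_smul]
    simp only [h]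
    rw [pow_succ, mul_apply_eq_comp]
    simp only [_root_.sum_apply, _root_.smul_apply, map_sum, map_smul]

variable [Fintype d] [DecidableEq d]

/-- The circuit `c` acts on states of ancilla and system as conjugation by `F`. -/
def ActsBy (H : Matrix d d ℂ) (A : ι → Matrix d d ℂ) (c : List (Op ι))
    (F : Matrix (Fin 2 × d) (Fin 2 × d) ℂ) : Prop :=
  ∀ X, c.foldl (fun X o => o.apply H A X) X = F * X * Fᴴ

lemma actsBy_nil (H : Matrix d d ℂ) (A : ι → Matrix d d ℂ) : ActsBy H A [] 1 := fun X => by simp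

lemma ActsBy.append {H : Matrix d d ℂ} {A : ι → Matrix d d ℂ} {c c' : List (Op ι)}
    {F F' : Matrix (Fin 2 × d) (Fin 2 × d) ℂ} (h : ActsBy H A c F) (h' : ActsBy H A c' F') :
    ActsBy H A (c ++ c') (F' * F) := fun X => by
  rw [List.foldl_append, h, h', Matrix.conjTranspose_mul]
  simp only [mul_assoc]

/-- The Hamiltonian evolution of the system, acting trivially on the ancilla. -/
noncomputable def systemEvolution (H : Matrix d d ℂ) (τ : ℝ) :
    Matrix (Fin 2 × d) (Fin 2 × d) ℂ :=
  (1 : Matrix (Fin 2) (Fin 2) ℂ) ⊗ₖ evolution H τ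

lemma actsBy_evolve (H : Matrix d d ℂ) (A : ι → Matrix d d ℂ) (τ : ℝ) :
    ActsBy H A [Op.evolve τ] (systemEvolution H τ) := fun _ => rfl

lemma actsBy_couple (H : Matrix d d ℂ) (A : ι → Matrix d d ℂ) (a : ι) (w : ℂ) :
    ActsBy H A [Op.couple a w] (coupling (A a) w) := fun _ => rfl

lemma systemEvolution_add (H : Matrix d d ℂ) (s r : ℝ) :
    systemEvolution H (s + r) = systemEvolution H s * systemEvolution H r := by
  rw [systemEvolution, systemEvolution, systemEvolution, ← Matrix.mul_kronecker_mul, one_mul,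
    evolution_add]

lemma systemEvolution_zero (H : Matrix d d ℂ) : systemEvolution H 0 = 1 := by
  rw [systemEvolution, evolution_zero, Matrix.one_kronecker_one]

lemma systemEvolution_mul_neg (H : Matrix d d ℂ) (s : ℝ) :
    systemEvolution H s * systemEvolution H (-s) = 1 := by
  rw [← systemEvolution_add, add_neg_cancel, systemEvolution_zero]

lemma systemEvolution_neg_mul (H : Matrix d d ℂ) (s : ℝ) :
    systemEvolution H (-s) * systemEvolution H s = 1 := by
  rw [← systemEvolution_add, neg_add_cancel, systemEvolution_zero]

/-- In the interaction picture a coupling gate couples to the evolved jump operator. -/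
lemma coupling_heisenberg (H A : Matrix d d ℂ) (s : ℝ) (w : ℂ) :
    coupling (heisenberg H A s) w
      = systemEvolution H (-s) * coupling A w * systemEvolution H s := by
  let u : (Matrix (Fin 2 × d) (Fin 2 × d) ℂ)ˣ := ⟨systemEvolution H (-s), systemEvolution H s,
    systemEvolution_neg_mul H s, systemEvolution_mul_neg H s⟩
  have e : couplingExponent (heisenberg H A s) w
      = systemEvolution H (-s) * couplingExponent A w * systemEvolution H s := by
    rw [couplingExponent, couplingExponent, heisenberg, systemEvolution, systemEvolution,
      Matrix.mul_smul, Matrix.smul_mul, ← Matrix.mul_kronecker_mul, ← Matrix.mul_kronecker_mul,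
      one_mul, mul_one]
  rw [← exp_couplingExponent, ← exp_couplingExponent, e]
  exact Matrix.exp_units_conj u (couplingExponent A w)

/-- The `j`-th gate of the product formula in the interaction picture. -/
noncomputable def gridGate (H A : Matrix d d ℂ) (β γ δ : ℝ) (S : ℕ) (Δ : ℝ) (j : ℕ) :
    Matrix d d ℂ × ℂ :=
  (heisenberg H A (((j : ℝ) - (S : ℝ)) * Δ), couplingCoeff β γ δ S Δ j)

/-- The palindromic sequence of gates of the product formula in the interaction picture. -/
noncomputable def gridGates (H A : Matrix d d ℂ) (β γ δ : ℝ) (S : ℕ) (Δ : ℝ) :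
    List (Matrix d d ℂ × ℂ) :=
  (List.range (2 * S + 1)).map (gridGate H A β γ δ S Δ)
    ++ ((List.range (2 * S + 1)).map (gridGate H A β γ δ S Δ)).reverse

/-- The product formula in the interaction picture. -/
noncomputable def gridUnitary (H A : Matrix d d ℂ) (β γ δ : ℝ) (S : ℕ) (Δ : ℝ) :
    Matrix (Fin 2 × d) (Fin 2 × d) ℂ :=
  ((gridGates H A β γ δ S Δ).map fun q => coupling q.1 q.2).prod

/-- The interleaved evolutions of the product formula telescope into the passage to the interaction
picture, up to the evolutions by `± S Δ` at the ends. -/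
lemma actsBy_productFormula (H : Matrix d d ℂ) (A : ι → Matrix d d ℂ) (β γ δ : ℝ) (S : ℕ) (Δ : ℝ)
    (a : ι) :
    ActsBy H A (productFormula β γ δ S Δ a) (systemEvolution H (-(S * Δ))
      * gridUnitary H (A a) β γ δ S Δ * systemEvolution H (S * Δ)) := by
  set w : ℕ → ℂ := couplingCoeff β γ δ S Δ with hw
  set s : ℕ → ℝ := fun j => ((j : ℝ) - (S : ℝ)) * Δ with hs
  set E := systemEvolution H with hE
  set B : ℕ → Matrix (Fin 2 × d) (Fin 2 × d) ℂ := fun j => coupling (A a) (w j) with hB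
  set W : ℕ → Matrix (Fin 2 × d) (Fin 2 × d) ℂ :=
    fun j => coupling (heisenberg H (A a) (s j)) (w j) with hW
  have hWB : ∀ j, W j = E (-s j) * B j * E (s j) := fun j => coupling_heisenberg H (A a) (s j) (w j)
  have hBE : ∀ j, B j * E (s j) = E (s j) * W j := fun j => by
    rw [hWB, ← mul_assoc, ← mul_assoc, systemEvolution_mul_neg, one_mul]
  have hEB : ∀ j, E (-s j) * B j = W j * E (-s j) := fun j => by
    rw [hWB, mul_assoc _ (E (s j)), systemEvolution_mul_neg, mul_one]
  have hs0 : s 0 = -(S * Δ) := by simp [hs]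
  have hsucc : ∀ n, s (n + 1) = Δ + s n := fun n => by simp [hs]; ring
  have hforward : ∀ n, ActsBy H A
      ((List.range n).flatMap fun j => [Op.couple a (w j), Op.evolve Δ])
      (E (s n) * ((List.range n).reverse.map W).prod * E (S * Δ)) := by
    intro n
    induction n with
    | zero =>
      have : E (s 0) * E (S * Δ) = 1 := by rw [hs0]; exact systemEvolution_neg_mul H _
      simpa [this] using actsBy_nil H A
    | succ n ih =>
      have h := ih.append ((actsBy_couple H A a (w n)).append (actsBy_evolve H A Δ))
      rw [List.range_succ, List.flatMap_append, List.reverse_append]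
      simp only [List.flatMap_cons, List.flatMap_nil, List.append_nil, List.reverse_singleton,
        List.singleton_append, List.map_cons, List.prod_cons]
      convert h using 1
      · rfl
      have h1 : coupling (A a) (w n) = B n := rfl
      rw [hsucc, hE, systemEvolution_add, ← hE, h1]
      simp only [mul_assoc]
      rw [← mul_assoc (B n), hBE]
      simp only [mul_assoc]
  have hbackward : ∀ n, ActsBy H A
      ((List.range n).reverse.flatMap fun j => [Op.evolve (-Δ), Op.couple a (w j)])
      (E (-(S * Δ)) * ((List.range n).map W).prod * E (-s n)) := by
    intro n
    induction n with
    | zero =>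
      have : E (-(S * Δ)) * E (-s 0) = 1 := by rw [hs0]; exact systemEvolution_mul_neg H _
      simpa [this] using actsBy_nil H A
    | succ n ih =>
      have h := ((actsBy_evolve H A (-Δ)).append (actsBy_couple H A a (w n))).append ih
      rw [List.range_succ, List.reverse_append]
      simp only [List.reverse_singleton, List.singleton_append, List.flatMap_cons,
        List.map_append, List.map_cons, List.map_nil, List.prod_append, List.prod_singleton]
      convert h using 1
      · rfl
      have h1 : coupling (A a) (w n) = B n := rfl
      rw [hsucc, neg_add, add_comm, hE, systemEvolution_add, ← hE, h1]
      simp only [mul_assoc]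
      rw [← mul_assoc (E (-s n)) (B n), hEB]
      simp only [mul_assoc]
  have hmid : ActsBy H A [Op.couple a (w (2 * S)), Op.couple a (w (2 * S))]
      (B (2 * S) * B (2 * S)) := (actsBy_couple H A a _).append (actsBy_couple H A a _)
  have h := ((hforward (2 * S)).append hmid).append (hbackward (2 * S))
  have hprod : gridUnitary H (A a) β γ δ S Δ
      = ((List.range (2 * S)).map W).prod * W (2 * S)
        * (W (2 * S) * ((List.range (2 * S)).reverse.map W).prod) := by
    have hg : ((fun q : Matrix d d ℂ × ℂ => coupling q.1 q.2) ∘ gridGate H (A a) β γ δ S Δ) = W :=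
      rfl
    rw [gridUnitary, gridGates, List.map_append, List.prod_append, ← List.map_reverse, List.map_map,
      List.map_map, hg, List.range_succ]
    simp
  convert h using 1
  · rfl
  rw [hprod]
  simp only [mul_assoc]
  congr 2
  rw [← mul_assoc (E (-s (2 * S))) (B (2 * S)), hEB]
  simp only [mul_assoc]
  rw [← mul_assoc (E (-s (2 * S))) (B (2 * S)), hEB]
  simp only [mul_assoc]
  rw [← mul_assoc (E (-s (2 * S))) (E (s (2 * S))), hE, systemEvolution_neg_mul, one_mul]

lemma block_systemEvolution (H : Matrix d d ℂ) (τ : ℝ) (k l : Fin 2) :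
    block k l (systemEvolution H τ) = if k = l then evolution H τ else 0 := by
  ext i j
  by_cases h : k = l <;> simp [block, systemEvolution, Matrix.kroneckerMap_apply, h]

lemma traceAnc_conj (F : Matrix (Fin 2 × d) (Fin 2 × d) ℂ) (ρ : Matrix d d ℂ) :
    traceAnc (F * (anc0 ⊗ₖ ρ) * Fᴴ)
      = block 0 0 F * ρ * (block 0 0 F)ᴴ + block 1 0 F * ρ * (block 1 0 F)ᴴ := by
  have h00 : block 0 0 (anc0 ⊗ₖ ρ) = ρ := by ext i j; simp [block, anc0]
  have h01 : block 0 1 (anc0 ⊗ₖ ρ) = 0 := by ext i j; simp [block, anc0]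
  have h10 : block 1 0 (anc0 ⊗ₖ ρ) = 0 := by ext i j; simp [block, anc0]
  have h11 : block 1 1 (anc0 ⊗ₖ ρ) = 0 := by ext i j; simp [block, anc0]
  rw [traceAnc_eq]
  simp [block_mul, block_conjTranspose, h00, h01, h10, h11]

/-- One step of the protocol in the interaction picture, as a map on states. -/
noncomputable def stepMap (H A : Matrix d d ℂ) (β γ δ : ℝ) (S : ℕ) (Δ : ℝ) :
    Matrix d d ℂ →L[ℂ] Matrix d d ℂ :=
  (sandwich (block 0 0 (gridUnitary H A β γ δ S Δ)) (block 0 0 (gridUnitary H A β γ δ S Δ))ᴴ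
    + sandwich (block 1 0 (gridUnitary H A β γ δ S Δ)) (block 1 0 (gridUnitary H A β γ δ S Δ))ᴴ)
  * sandwich (evolution H δ) (evolution H (-δ))

lemma foldl_protocolStep {H : Matrix d d ℂ} (hH : H.IsHermitian) (A : ι → Matrix d d ℂ)
    (β γ δ : ℝ) (S : ℕ) (Δ : ℝ) (a : ι) (ρ : Matrix d d ℂ) :
    (protocolStep β γ δ S Δ a).foldl (fun X o => o.apply H A X) (anc0 ⊗ₖ ρ)
      = anc0 ⊗ₖ (sandwich (evolution H (-(S * Δ))) (evolution H (S * Δ))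
          * stepMap H (A a) β γ δ S Δ
          * sandwich (evolution H (S * Δ)) (evolution H (-(S * Δ)))) ρ := by
  rw [protocolStep, List.foldl_append,
    (actsBy_evolve H A δ).append (actsBy_productFormula H A β γ δ S Δ a)]
  change anc0 ⊗ₖ traceAnc _ = _
  rw [traceAnc_conj]
  congr 1
  simp only [stepMap, mul_apply_eq_comp, _root_.add_apply, ContinuousLinearMap.mulLeftRight_apply,
    block_mul, block_systemEvolution, Matrix.conjTranspose_mul, Matrix.conjTranspose_add]
  simp [conjTranspose_evolution hH, mul_add, add_mul, mul_assoc]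
  have hcomm : ∀ x y : ℝ, ∀ Z : Matrix d d ℂ,
      evolution H x * (evolution H y * Z) = evolution H y * (evolution H x * Z) := fun x y Z => by
    rw [← mul_assoc, ← mul_assoc, ← evolution_add, ← evolution_add, add_comm]
  simp only [hcomm (S * Δ) δ, hcomm (-δ) (-(S * Δ))]

/-- In the protocol the evolutions by `± S Δ` cancel between consecutive steps. -/
lemma runCircuit_protocol {H : Matrix d d ℂ} (hH : H.IsHermitian) (A : ι → Matrix d d ℂ)
    (β γ δ : ℝ) (S : ℕ) (Δ : ℝ) (as : List ι) (ρ : Matrix d d ℂ) :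
    runCircuit H A (protocol β γ δ S Δ as) ρ
      = as.foldl (fun X a => stepMap H (A a) β γ δ S Δ X) ρ := by
  set R := sandwich (evolution H (S * Δ)) (evolution H (-(S * Δ))) with hR
  set R' := sandwich (evolution H (-(S * Δ))) (evolution H (S * Δ)) with hR'
  have hRR : R * R' = 1 := by
    rw [hR, hR', sandwich_mul_sandwich, evolution_mul_neg, sandwich_one_one]
  have hRR' : ∀ X, R (R' X) = X := fun X => by rw [← mul_apply_eq_comp, hRR]; rfl
  have hsteps : ∀ (as : List ι) (X : Matrix d d ℂ),
      (as.flatMap (protocolStep β γ δ S Δ)).foldl (fun X o => o.apply H A X) (anc0 ⊗ₖ R' X)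
        = anc0 ⊗ₖ R' (as.foldl (fun X a => stepMap H (A a) β γ δ S Δ X) X) := by
    intro as
    induction as with
    | nil => intro X; rfl
    | cons a as ih =>
      intro X
      rw [List.flatMap_cons, List.foldl_append, foldl_protocolStep hH, ← hR, ← hR',
        mul_apply_eq_comp, mul_apply_eq_comp, hRR', ih, List.foldl_cons]
  have hev : ∀ (τ : ℝ) (X : Matrix d d ℂ), [Op.evolve (ι := ι) τ].foldl (fun X o => o.apply H A X)
      (anc0 ⊗ₖ X) = anc0 ⊗ₖ (evolution H τ * X * evolution H (-τ)) := fun τ X => by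
    simp [Op.apply, Matrix.conjTranspose_kronecker, conjTranspose_evolution hH,
      ← Matrix.mul_kronecker_mul]
  have hfirst := hev (-(S * Δ)) ρ
  rw [neg_neg] at hfirst
  rw [runCircuit, protocol, List.foldl_append, List.foldl_append, hfirst]
  have h2 := hsteps as ρ
  rw [hR', ContinuousLinearMap.mulLeftRight_apply] at h2
  rw [h2, hev, traceAnc_anc0]
  exact hRR' _

/-- The mean step of the protocol in the interaction and Heisenberg picture. -/
noncomputable def meanStepDual [Fintype ι] (H : Matrix d d ℂ) (A : ι → Matrix d d ℂ) (p : ι → ℝ)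
    (β γ δ : ℝ) (S : ℕ) (Δ : ℝ) : Matrix d d ℂ →L[ℂ] Matrix d d ℂ :=
  sandwich (evolution H (-δ)) (evolution H δ)
    * ∑ a, (p a : ℂ) • dilationDual (gridUnitary H (A a) β γ δ S Δ)

lemma trace_mul_protocolOutput [Fintype ι] {H : Matrix d d ℂ} (hH : H.IsHermitian)
    (A : ι → Matrix d d ℂ) (p : ι → ℝ) (β γ t : ℝ) (M S : ℕ) (Δ : ℝ) (Y ρ : Matrix d d ℂ) :
    (Y * protocolOutput H A p β γ t M S Δ ρ).trace
      = ((meanStepDual H A p β γ (t / M) S Δ ^ M) Y * ρ).trace := by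
  have h : IsTraceDual (∑ a, (p a : ℂ) • stepMap H (A a) β γ (t / M) S Δ)
      (meanStepDual H A p β γ (t / M) S Δ) := by
    rw [meanStepDual, Finset.mul_sum]
    refine IsTraceDual.sum _ fun a => ?_
    have e : sandwich (evolution H (-(t / M))) (evolution H (t / M))
          * (p a : ℂ) • dilationDual (gridUnitary H (A a) β γ (t / M) S Δ)
        = (p a : ℂ) • (sandwich (evolution H (-(t / M))) (evolution H (t / M))
          * dilationDual (gridUnitary H (A a) β γ (t / M) S Δ)) := by
      ext1 X
      simp only [mul_apply_eq_comp, _root_.smul_apply, map_smul]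
    rw [e]
    refine IsTraceDual.smul (IsTraceDual.mul ?_ (isTraceDual_sandwich _ _)) _
    exact (isTraceDual_sandwich _ _).add (isTraceDual_sandwich _ _)
  rw [protocolOutput]
  simp only [runCircuit_protocol hH]
  rw [sum_prod_smul_foldl, h.pow M]

end Semantics

/-! ### Trace norm and operator norm -/

section TraceNorm

variable {d : Type} [Fintype d] [DecidableEq d]

lemma norm_entry_le_l2_opNorm (X : Matrix d d ℂ) (i j : d) : ‖X i j‖ ≤ ‖X‖ := by
  have h := Matrix.l2_opNorm_mulVec X (EuclideanSpace.single j (1 : ℂ))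
  have h2 := PiLp.norm_apply_le
    ((EuclideanSpace.equiv d ℂ).symm (X.mulVec (EuclideanSpace.single j (1 : ℂ)))) i
  rw [PiLp.norm_single, norm_one, mul_one] at h
  refine le_trans (le_of_eq ?_) (h2.trans h)
  simp

lemma norm_unitary_le_one {U : Matrix d d ℂ} (hU : U ∈ unitary (Matrix d d ℂ)) : ‖U‖ ≤ 1 := by
  have h := Matrix.l2_opNorm_conjTranspose_mul_self U
  have h2 : Uᴴ * U = 1 := hU.1
  rw [h2] at h
  nlinarith [norm_one_matrix_le (n := d), norm_nonneg U]

lemma norm_unitary_conj_le {U : Matrix d d ℂ} (hU : U ∈ unitary (Matrix d d ℂ))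
    (Z : Matrix d d ℂ) : ‖U * Z * Uᴴ‖ ≤ ‖Z‖ := by
  have h1 := norm_unitary_le_one hU
  have h2 : ‖Uᴴ‖ ≤ 1 := by rwa [Matrix.l2_opNorm_conjTranspose]
  calc ‖U * Z * Uᴴ‖ ≤ ‖U‖ * ‖Z‖ * ‖Uᴴ‖ := norm_mul₃_le
    _ ≤ 1 * ‖Z‖ * 1 := by gcongr
    _ = ‖Z‖ := by ring

lemma spectral_decomposition {B : Matrix d d ℂ} (hB : B.IsHermitian) :
    B = (hB.eigenvectorUnitary : Matrix d d ℂ) * Matrix.diagonal (fun i => (hB.eigenvalues i : ℂ))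
      * (hB.eigenvectorUnitary : Matrix d d ℂ)ᴴ := by
  have h := hB.spectral_theorem
  rw [Unitary.conjStarAlgAut_apply] at h
  exact h

/-- Density matrices are bounded functionals of norm one on observables. -/
lemma norm_trace_mul_density_le {ρ : Matrix d d ℂ} (hρ : IsDensity ρ) (Z : Matrix d d ℂ) :
    ‖(Z * ρ).trace‖ ≤ ‖Z‖ := by
  obtain ⟨hpos, htr⟩ := hρ
  set U : Matrix d d ℂ := (hpos.1.eigenvectorUnitary : Matrix d d ℂ) with hU
  set μ := hpos.1.eigenvalues with hμ
  have hUm : U ∈ unitary (Matrix d d ℂ) := hpos.1.eigenvectorUnitary.2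
  have hspec : ρ = U * Matrix.diagonal (fun i => (μ i : ℂ)) * Uᴴ := spectral_decomposition hpos.1
  have hsum : ∑ i, μ i = 1 := by
    have h : ρ.trace = ∑ i, ((μ i : ℝ) : ℂ) := hpos.1.trace_eq_sum_eigenvalues
    rw [htr, ← Complex.ofReal_sum] at h
    exact Complex.ofReal_injective h.symm
  have hn : ‖Uᴴ * Z * U‖ ≤ ‖Z‖ := by
    have h := norm_unitary_conj_le (Unitary.star_mem hUm) Z
    rwa [Matrix.star_eq_conjTranspose, Matrix.conjTranspose_conjTranspose] at h
  have e : (Z * ρ).trace = ∑ i, (Uᴴ * Z * U) i i * (μ i : ℂ) := by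
    rw [hspec, ← mul_assoc, Matrix.trace_mul_comm, ← mul_assoc, ← mul_assoc]
    simp only [Matrix.trace, Matrix.diag, Matrix.mul_diagonal]
  rw [e]
  calc _ ≤ ∑ i, ‖(Uᴴ * Z * U) i i * (μ i : ℂ)‖ := norm_sum_le _ _
    _ ≤ ∑ i, ‖Z‖ * μ i := by
        refine Finset.sum_le_sum fun i _ => ?_
        rw [norm_mul, Complex.norm_real, Real.norm_of_nonneg (hpos.eigenvalues_nonneg i)]
        exact mul_le_mul_of_nonneg_right ((norm_entry_le_l2_opNorm _ _ _).trans hn)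
          (hpos.eigenvalues_nonneg i)
    _ = ‖Z‖ := by rw [← Finset.mul_sum, hsum, mul_one]

/-- The adjoint `Y` of the partial isometry in the polar decomposition of `X` is a contraction, and
`Y X = √(Xᴴ X)`. -/
lemma exists_contraction_trace_eq {X U : Matrix d d ℂ} (hU : U ∈ unitary (Matrix d d ℂ))
    {μ : d → ℝ}
    (hspec : Xᴴ * X = U * Matrix.diagonal (fun i => (μ i : ℂ)) * Uᴴ) :
    ∃ Y : Matrix d d ℂ, ‖Y‖ ≤ 1 ∧ (Y * X).trace = ((∑ i, √(μ i) : ℝ) : ℂ) := by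
  have hUU : Uᴴ * U = 1 := hU.1
  -- `√(μ i)⁻¹` is zero at the vanishing singular values, as it should be
  set D : Matrix d d ℂ := Matrix.diagonal (fun i => (((√(μ i))⁻¹ : ℝ) : ℂ)) with hD
  set N : Matrix d d ℂ := Matrix.diagonal (fun i => (μ i : ℂ)) with hN
  have hDH : Dᴴ = D := by
    rw [hD, Matrix.diagonal_conjTranspose]
    congr 1
    ext i
    simp
  have hinv : ∀ i, (√(μ i))⁻¹ * μ i = √(μ i) := fun i => by
    rw [inv_mul_eq_div, Real.div_sqrt]
  refine ⟨U * D * Uᴴ * Xᴴ, ?_, ?_⟩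
  · have hd : ‖D * N * D‖ ≤ 1 := by
      rw [hD, hN, Matrix.diagonal_mul_diagonal, Matrix.diagonal_mul_diagonal,
        Matrix.l2_opNorm_diagonal]
      refine (pi_norm_le_iff_of_nonneg zero_le_one).2 fun i => ?_
      rw [← Complex.ofReal_mul, hinv, ← Complex.ofReal_mul, Complex.norm_real,
        Real.norm_of_nonneg (by positivity)]
      exact mul_inv_le_one
    have e : (U * D * Uᴴ * Xᴴ) * (U * D * Uᴴ * Xᴴ)ᴴ = U * (D * N * D) * Uᴴ := by
      simp only [Matrix.conjTranspose_mul, Matrix.conjTranspose_conjTranspose, hDH]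
      calc U * D * Uᴴ * Xᴴ * (X * (U * (D * Uᴴ)))
          = U * D * Uᴴ * (Xᴴ * X) * (U * (D * Uᴴ)) := by simp only [mul_assoc]
        _ = U * D * (Uᴴ * U) * N * (Uᴴ * U) * (D * Uᴴ) := by rw [hspec]; simp only [mul_assoc]
        _ = U * (D * N * D) * Uᴴ := by rw [hUU]; simp only [mul_assoc, mul_one]
    have h1 := Matrix.l2_opNorm_conjTranspose_mul_self (U * D * Uᴴ * Xᴴ)ᴴ
    rw [Matrix.l2_opNorm_conjTranspose (U * D * Uᴴ * Xᴴ), Matrix.conjTranspose_conjTranspose, e]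
      at h1
    nlinarith [norm_nonneg (U * D * Uᴴ * Xᴴ), norm_unitary_conj_le hU (D * N * D)]
  · have e : U * D * Uᴴ * Xᴴ * X = U * (D * N) * Uᴴ := by
      calc U * D * Uᴴ * Xᴴ * X = U * D * Uᴴ * (Xᴴ * X) := by simp only [mul_assoc]
        _ = U * D * (Uᴴ * U) * N * Uᴴ := by rw [hspec]; simp only [mul_assoc]
        _ = U * (D * N) * Uᴴ := by rw [hUU]; simp only [mul_assoc, one_mul]
    rw [e, Matrix.trace_mul_comm, ← mul_assoc, hUU, one_mul, hD, hN, Matrix.diagonal_mul_diagonal,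
      Matrix.trace_diagonal, Complex.ofReal_sum]
    refine Finset.sum_congr rfl fun i _ => ?_
    rw [← Complex.ofReal_mul, hinv]

/-- The trace norm is at most the dual of the operator norm. -/
lemma traceNorm_le_of_forall_trace_le (X : Matrix d d ℂ) {c : ℝ}
    (h : ∀ Y : Matrix d d ℂ, ‖Y‖ ≤ 1 → ‖(Y * X).trace‖ ≤ c) : traceNorm X ≤ c := by
  have hH := Matrix.isHermitian_conjTranspose_mul_self X
  obtain ⟨Y, hY, htr⟩ := exists_contraction_trace_eq (X := X) hH.eigenvectorUnitary.2
    (spectral_decomposition hH)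
  have := h Y hY
  rw [htr, Complex.norm_real] at this
  exact (le_abs_self _).trans this

end TraceNorm

/-! ### The Gaussian filter and its jump operators -/

section Filter

open MeasureTheory Filter Topology

/-- A Gaussian of twice the variance that dominates the filter, its derivative and its tails
up to constants. -/
noncomputable def envelope (β s : ℝ) : ℝ :=
  1 / (Real.pi ^ (3 / 4 : ℝ) * √β) * Real.exp (-(s / β) ^ 2)

lemma envelope_nonneg (β s : ℝ) : 0 ≤ envelope β s := by
  unfold envelope; positivity

lemma integrable_envelope {β : ℝ} (hβ : 0 < β) : Integrable (envelope β) := by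
  have h : Integrable fun s : ℝ => Real.exp (-(1 / β ^ 2) * s ^ 2) :=
    integrable_exp_neg_mul_sq (by positivity)
  refine (h.const_mul (1 / (Real.pi ^ (3 / 4 : ℝ) * √β))).congr (Eventually.of_forall fun s => ?_)
  simp only [envelope]
  congr 2
  field_simp

lemma integral_envelope_le {β : ℝ} (hβ : 0 < β) : ∫ s, envelope β s ≤ √β := by
  have h : ∫ s, envelope β s
      = 1 / (Real.pi ^ (3 / 4 : ℝ) * √β) * √(Real.pi / (1 / β ^ 2)) := by
    rw [← integral_gaussian, ← integral_const_mul]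
    congr 1
    ext s
    simp only [envelope]
    congr 2
    field_simp
  have h1 : √(Real.pi / (1 / β ^ 2)) = √Real.pi * β := by
    rw [div_div_eq_mul_div, div_one, Real.sqrt_mul Real.pi_pos.le, Real.sqrt_sq hβ.le]
  have h2 : √Real.pi ≤ Real.pi ^ (3 / 4 : ℝ) := by
    rw [Real.sqrt_eq_rpow]
    exact Real.rpow_le_rpow_of_exponent_le (by linarith [Real.pi_gt_three]) (by norm_num)
  have hb : 0 < √β := Real.sqrt_pos.2 hβ
  rw [h, h1, one_div, inv_mul_eq_div, div_le_iff₀ (by positivity)]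
  calc √Real.pi * β ≤ Real.pi ^ (3 / 4 : ℝ) * β := by gcongr
    _ = √β * (Real.pi ^ (3 / 4 : ℝ) * √β) := by
        nth_rewrite 1 [← Real.mul_self_sqrt hβ.le]
        ring

lemma norm_filter (β s : ℝ) : ‖filter β s‖ = Real.exp (-(s / β) ^ 2) * envelope β s := by
  have h1 : ‖Complex.exp (Complex.I * ((s / β : ℝ) : ℂ))‖ = 1 := by
    rw [mul_comm]
    exact Complex.norm_exp_ofReal_mul_I _
  have h2 : (-2 * s ^ 2 / β ^ 2 : ℝ) = -(s / β) ^ 2 + -(s / β) ^ 2 := by ring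
  rw [filter, norm_mul, norm_mul, h1, Complex.norm_real, Complex.norm_real,
    Real.norm_of_nonneg (by positivity), Real.norm_of_nonneg (by positivity), h2, Real.exp_add,
    envelope]
  ring

lemma norm_filter_le (β s : ℝ) : ‖filter β s‖ ≤ envelope β s := by
  rw [norm_filter]
  exact mul_le_of_le_one_left (envelope_nonneg _ _)
    (Real.exp_le_one_iff.2 (neg_nonpos.2 (sq_nonneg _)))

lemma hasDerivAt_filter {β : ℝ} (s : ℝ) :
    HasDerivAt (filter β)
      ((Complex.I * ((1 / β : ℝ) : ℂ) + ((-4 * s / β ^ 2 : ℝ) : ℂ)) * filter β s) s := by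
  have h1 : HasDerivAt (fun s : ℝ => Complex.exp (Complex.I * ((s / β : ℝ) : ℂ)))
      (Complex.exp (Complex.I * ((s / β : ℝ) : ℂ)) * (Complex.I * ((1 / β : ℝ) : ℂ))) s := by
    have := ((((hasDerivAt_id s).div_const β).ofReal_comp).const_mul Complex.I).cexp
    simpa using this
  have h2 : HasDerivAt (fun s : ℝ => ((Real.exp (-2 * s ^ 2 / β ^ 2) : ℝ) : ℂ))
      ((Real.exp (-2 * s ^ 2 / β ^ 2) * (-4 * s / β ^ 2) : ℝ) : ℂ) s := by
    have h3 : HasDerivAt (fun s : ℝ => -2 * s ^ 2 / β ^ 2) (-4 * s / β ^ 2) s := by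
      refine (((hasDerivAt_pow 2 s).const_mul (-2)).div_const (β ^ 2)).congr_deriv ?_
      push_cast
      ring
    exact h3.exp.ofReal_comp
  have h := (h1.const_mul (((1 / (Real.pi ^ (3 / 4 : ℝ) * √β) : ℝ) : ℂ))).mul h2
  refine h.congr_deriv ?_
  simp only [filter]
  push_cast
  ring

lemma continuous_filter (β : ℝ) : Continuous (filter β) :=
  continuous_iff_continuousAt.2 fun s => (hasDerivAt_filter s).continuousAt

lemma norm_deriv_filter_le {β : ℝ} (hβ : 0 < β) (s : ℝ) :
    ‖(Complex.I * ((1 / β : ℝ) : ℂ) + ((-4 * s / β ^ 2 : ℝ) : ℂ)) * filter β s‖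
      ≤ 5 / β * envelope β s := by
  set u : ℝ := s / β with hu
  have h1 : ‖Complex.I * ((1 / β : ℝ) : ℂ) + ((-4 * s / β ^ 2 : ℝ) : ℂ)‖
      ≤ 1 / β * (1 + 4 * |u|) := by
    refine (norm_add_le _ _).trans (le_of_eq ?_)
    rw [norm_mul, Complex.norm_I, one_mul, Complex.norm_real, Complex.norm_real,
      Real.norm_of_nonneg (by positivity), Real.norm_eq_abs, hu, abs_div, abs_div, abs_mul,
      abs_of_pos hβ, abs_of_pos (by positivity : 0 < β ^ 2), abs_neg, abs_of_pos four_pos]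
    field_simp
  have h2 : (1 + 4 * |u|) * Real.exp (-u ^ 2) ≤ 5 := by
    have h3 : Real.exp (-u ^ 2) ≤ 1 := Real.exp_le_one_iff.2 (neg_nonpos.2 (sq_nonneg _))
    have h4 : |u| * Real.exp (-u ^ 2) ≤ 1 := by
      have h5 : |u| ≤ Real.exp (u ^ 2) := by
        have := Real.add_one_le_exp (u ^ 2)
        nlinarith [sq_abs u, sq_nonneg (|u| - 1)]
      calc |u| * Real.exp (-u ^ 2) ≤ Real.exp (u ^ 2) * Real.exp (-u ^ 2) := by gcongr
        _ = 1 := by rw [← Real.exp_add, add_neg_cancel, Real.exp_zero]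
    linarith
  rw [norm_mul, norm_filter, ← hu]
  have he := envelope_nonneg β s
  calc _ ≤ 1 / β * (1 + 4 * |u|) * (Real.exp (-u ^ 2) * envelope β s) := by gcongr
    _ = 1 / β * ((1 + 4 * |u|) * Real.exp (-u ^ 2)) * envelope β s := by ring
    _ ≤ 1 / β * 5 * envelope β s := by gcongr
    _ = _ := by ring

variable {d : Type} [Fintype d] [DecidableEq d]

lemma norm_heisenberg_le {H : Matrix d d ℂ} (hH : H.IsHermitian) (A : Matrix d d ℂ) (s : ℝ) :
    ‖heisenberg H A s‖ ≤ ‖A‖ := by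
  calc ‖heisenberg H A s‖ ≤ ‖evolution H (-s)‖ * ‖A‖ * ‖evolution H s‖ := norm_mul₃_le
    _ ≤ 1 * ‖A‖ * 1 := by gcongr <;> exact norm_evolution_le hH _
    _ = ‖A‖ := by ring

lemma isHermitian_heisenberg {H A : Matrix d d ℂ} (hH : H.IsHermitian) (hA : A.IsHermitian)
    (s : ℝ) : (heisenberg H A s).IsHermitian := by
  rw [Matrix.IsHermitian, heisenberg, Matrix.conjTranspose_mul, Matrix.conjTranspose_mul,
    conjTranspose_evolution hH, conjTranspose_evolution hH, hA.eq, neg_neg, mul_assoc]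

lemma hasDerivAt_heisenberg (H A : Matrix d d ℂ) (s : ℝ) :
    HasDerivAt (heisenberg H A)
      (Complex.I • (H * heisenberg H A s - heisenberg H A s * H)) s := by
  have hev : ∀ s : ℝ, evolution H s = NormedSpace.exp ((s : ℂ) • (-Complex.I) • H) := fun s => by
    rw [evolution]
    congr 1
    module
  have hev' : ∀ s : ℝ, evolution H (-s) = NormedSpace.exp ((s : ℂ) • Complex.I • H) := fun s => by
    rw [evolution]
    congr 1
    push_cast
    module
  have h := ((hasDerivAt_exp_ofReal_smul' (Complex.I • H) s).mul_const A).mul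
    (hasDerivAt_exp_ofReal_smul ((-Complex.I) • H) s)
  have hf : heisenberg H A = (fun s : ℝ => NormedSpace.exp ((s : ℂ) • Complex.I • H) * A)
      * fun s : ℝ => NormedSpace.exp ((s : ℂ) • (-Complex.I) • H) := by
    ext1 s
    rw [heisenberg, hev', hev, Pi.mul_apply]
  rw [hf]
  refine h.congr_deriv ?_
  simp only [Pi.mul_apply, Matrix.smul_mul, Matrix.mul_smul, mul_assoc]
  module

lemma continuous_heisenberg (H A : Matrix d d ℂ) : Continuous (heisenberg H A) :=
  continuous_iff_continuousAt.2 fun s => (hasDerivAt_heisenberg H A s).continuousAt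

lemma continuous_filter_smul_heisenberg (β : ℝ) (H A : Matrix d d ℂ) :
    Continuous fun s => filter β s • heisenberg H A s :=
  (continuous_filter β).smul (continuous_heisenberg H A)

lemma norm_filter_smul_heisenberg_le {H : Matrix d d ℂ} (hH : H.IsHermitian) (A : Matrix d d ℂ)
    (β s : ℝ) : ‖filter β s • heisenberg H A s‖ ≤ envelope β s * ‖A‖ := by
  rw [norm_smul]
  exact mul_le_mul (norm_filter_le β s) (norm_heisenberg_le hH A s) (norm_nonneg _)
    (envelope_nonneg _ _)

lemma integrable_filter_smul_heisenberg {β : ℝ} (hβ : 0 < β) {H : Matrix d d ℂ}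
    (hH : H.IsHermitian) (A : Matrix d d ℂ) :
    Integrable fun s => filter β s • heisenberg H A s :=
  ((integrable_envelope hβ).mul_const ‖A‖).mono'
    (continuous_filter_smul_heisenberg β H A).aestronglyMeasurable
    (Eventually.of_forall (norm_filter_smul_heisenberg_le hH A β))

lemma norm_jump_le {β : ℝ} (hβ : 0 < β) {H : Matrix d d ℂ} (hH : H.IsHermitian)
    (A : Matrix d d ℂ) : ‖jump β H A‖ ≤ √β * ‖A‖ := by
  refine (norm_integral_le_of_norm_le ((integrable_envelope hβ).mul_const ‖A‖)
    (Eventually.of_forall (norm_filter_smul_heisenberg_le hH A β))).trans ?_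
  rw [integral_mul_const]
  gcongr
  exact integral_envelope_le hβ

/-- The commutator of the Hamiltonian with a jump operator is bounded independently of the
Hamiltonian: an integration by parts moves it to a derivative of the filter. -/
lemma norm_commutator_jump_le {β : ℝ} (hβ : 0 < β) {H : Matrix d d ℂ} (hH : H.IsHermitian)
    (A : Matrix d d ℂ) : ‖H * jump β H A - jump β H A * H‖ ≤ 5 / √β * ‖A‖ := by
  set f : ℝ → Matrix d d ℂ := fun s => filter β s • heisenberg H A s with hf
  set f₁ : ℝ → Matrix d d ℂ := fun s =>
    ((Complex.I * ((1 / β : ℝ) : ℂ) + ((-4 * s / β ^ 2 : ℝ) : ℂ)) * filter β s)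
      • heisenberg H A s with hf₁
  have hfi : Integrable f := integrable_filter_smul_heisenberg hβ hH A
  have hf₁n : ∀ s, ‖f₁ s‖ ≤ 5 / β * envelope β s * ‖A‖ := fun s => by
    rw [hf₁, norm_smul]
    have := envelope_nonneg β s
    exact mul_le_mul (norm_deriv_filter_le hβ s) (norm_heisenberg_le hH A s) (norm_nonneg _)
      (by positivity)
  have hdom : Integrable fun s => 5 / β * envelope β s * ‖A‖ :=
    ((integrable_envelope hβ).const_mul _).mul_const _
  have hf₁c : Continuous f₁ := by
    refine Continuous.smul (Continuous.mul ?_ (continuous_filter β)) (continuous_heisenberg H A)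
    refine continuous_const.add (Complex.continuous_ofReal.comp ?_)
    fun_prop
  have hf₁i : Integrable f₁ := hdom.mono' hf₁c.aestronglyMeasurable (Eventually.of_forall hf₁n)
  -- the commutator is a bounded linear map, so it passes under the integral
  let ad : Matrix d d ℂ →L[ℂ] Matrix d d ℂ := hamiltonianDual H
  have hadi : Integrable fun s => ad (f s) := ad.integrable_comp hfi
  have hderiv : ∀ s, HasDerivAt f (f₁ s + ad (f s)) s := fun s => by
    have h := (hasDerivAt_filter (β := β) s).smul (hasDerivAt_heisenberg H A s)
    refine h.congr_deriv ?_
    simp only [ad, hamiltonianDual_apply, hf, hf₁, Matrix.mul_smul, Matrix.smul_mul]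
    module
  have hzero := integral_eq_zero_of_hasDerivAt_of_integrable hderiv (hf₁i.add hadi) hfi
  rw [integral_add hf₁i hadi, ad.integral_comp_comm hfi] at hzero
  have hval : ad (∫ s, f s) = Complex.I • (H * jump β H A - jump β H A * H) :=
    hamiltonianDual_apply H _
  have hn : ‖H * jump β H A - jump β H A * H‖ = ‖∫ s, f₁ s‖ := by
    rw [eq_neg_of_add_eq_zero_left hzero, hval, norm_neg, norm_smul, Complex.norm_I, one_mul]
  rw [hn]
  refine (norm_integral_le_of_norm_le hdom (Eventually.of_forall hf₁n)).trans ?_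
  rw [integral_mul_const, integral_const_mul]
  have hb : 0 < √β := Real.sqrt_pos.2 hβ
  calc 5 / β * (∫ s, envelope β s) * ‖A‖ ≤ 5 / β * √β * ‖A‖ := by
        gcongr
        exact integral_envelope_le hβ
    _ = 5 / √β * ‖A‖ := by
        congr 1
        rw [div_mul_eq_mul_div, div_eq_div_iff hβ.ne' hb.ne', mul_assoc, Real.mul_self_sqrt hβ.le]

/-- Truncation error: the filter is `exp (-(s / β)²)` times its envelope, and the first factor is
small outside `[-T, T]`. -/
lemma norm_jump_sub_truncated_le {β : ℝ} (hβ : 0 < β) {H : Matrix d d ℂ} (hH : H.IsHermitian)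
    (A : Matrix d d ℂ) {T : ℝ} (hT : 0 ≤ T) :
    ‖jump β H A - ∫ s in (-T)..T, filter β s • heisenberg H A s‖
      ≤ Real.exp (-(T / β) ^ 2) * (√β * ‖A‖) := by
  set f : ℝ → Matrix d d ℂ := fun s => filter β s • heisenberg H A s with hf
  have hfi : Integrable f := integrable_filter_smul_heisenberg hβ hH A
  have hsplit : jump β H A - ∫ s in (-T)..T, f s = ∫ s in (Set.Ioc (-T) T)ᶜ, f s := by
    have h : (∫ s in Set.Ioc (-T) T, f s) + ∫ s in (Set.Ioc (-T) T)ᶜ, f s = jump β H A :=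
      integral_add_compl measurableSet_Ioc hfi
    rw [intervalIntegral.integral_of_le (by linarith), ← h, add_sub_cancel_left]
  have hdom : Integrable fun s => Real.exp (-(T / β) ^ 2) * (envelope β s * ‖A‖) :=
    ((integrable_envelope hβ).mul_const _).const_mul _
  have hb : ∀ᵐ s ∂(volume.restrict (Set.Ioc (-T) T)ᶜ),
      ‖f s‖ ≤ Real.exp (-(T / β) ^ 2) * (envelope β s * ‖A‖) := by
    refine (ae_restrict_mem measurableSet_Ioc.compl).mono fun s hs => ?_
    have hTs : T ^ 2 ≤ s ^ 2 := by
      rw [sq_le_sq, abs_of_nonneg hT]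
      by_contra! h
      exact hs ⟨(abs_lt.1 h).1, (abs_lt.1 h).2.le⟩
    have h1 : Real.exp (-(s / β) ^ 2) ≤ Real.exp (-(T / β) ^ 2) := by
      rw [div_pow, div_pow]
      gcongr
    have he := envelope_nonneg β s
    rw [hf, norm_smul, norm_filter, mul_assoc]
    have := norm_heisenberg_le hH A s
    gcongr
  rw [hsplit]
  refine (norm_integral_le_of_norm_le hdom.integrableOn hb).trans ?_
  refine (setIntegral_le_integral hdom (Eventually.of_forall fun s => ?_)).trans ?_
  · have he := envelope_nonneg β s
    simp only [Pi.zero_apply]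
    positivity
  · rw [integral_const_mul, integral_mul_const]
    gcongr
    exact integral_envelope_le hβ

/-- Trapezoidal sums of a continuous function converge to its integral. -/
lemma tendsto_trapezoidal_sum {E : Type*} [NormedAddCommGroup E] [NormedSpace ℝ E]
    [CompleteSpace E] {f : ℝ → E} (hf : Continuous f) {T : ℝ} (hT : 0 < T) :
    Tendsto (fun S : ℕ => ∑ j ∈ Finset.range (2 * S + 1),
        trapWeight S (T / S) j • f (((j : ℝ) - (S : ℝ)) * (T / S))) atTop
      (𝓝 (∫ s in (-T)..T, f s)) := by
  rw [Metric.tendsto_atTop]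
  intro ε hε
  have huc : UniformContinuousOn f (Set.Icc (-T) T) :=
    isCompact_Icc.uniformContinuousOn_of_continuous hf.continuousOn
  obtain ⟨η, hη, hfη⟩ := Metric.uniformContinuousOn_iff.1 huc (ε / (4 * T)) (by positivity)
  obtain ⟨N, hN⟩ := exists_nat_gt (T / η)
  refine ⟨N + 1, fun S hS => ?_⟩
  have hS0 : 0 < S := by omega
  have hS0' : (0 : ℝ) < S := by exact_mod_cast hS0
  set Δ : ℝ := T / S with hΔ
  have hΔ0 : 0 < Δ := by positivity
  have hΔη : Δ < η := by
    rw [hΔ, div_lt_iff₀ hS0', ← div_lt_iff₀' hη]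
    refine hN.trans ?_
    exact_mod_cast (by omega : N < S)
  have hSΔ : S * Δ = T := by rw [hΔ]; field_simp
  set s : ℕ → ℝ := fun j => ((j : ℝ) - (S : ℝ)) * Δ with hs
  have hsucc : ∀ j, s (j + 1) = s j + Δ := fun j => by simp [hs]; ring
  have hs0 : s 0 = -T := by simp [hs, hSΔ]
  have hsN : s (2 * S) = T := by simp [hs]; linarith
  have hsum : ∑ j ∈ Finset.range (2 * S + 1), trapWeight S Δ j • f (s j)
      = ∑ j ∈ Finset.range (2 * S), ((Δ / 2) • f (s j) + (Δ / 2) • f (s (j + 1))) := by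
    have hw : ∀ j, trapWeight S Δ j
        = (if j = 2 * S then 0 else Δ / 2) + (if j = 0 then 0 else Δ / 2) := fun j => by
      unfold trapWeight
      by_cases h1 : j = 2 * S <;> by_cases h2 : j = 0
      · omega
      · simp [h1]; omega
      · simp [h2]; omega
      · simp [h1, h2]
    simp only [hw, add_smul, Finset.sum_add_distrib]
    congr 1
    · rw [Finset.sum_range_succ, if_pos rfl, zero_smul, add_zero]
      refine Finset.sum_congr rfl fun j hj => ?_
      rw [if_neg (Finset.mem_range.1 hj).ne]
    · rw [Finset.sum_range_succ', if_pos rfl, zero_smul, add_zero]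
      refine Finset.sum_congr rfl fun j hj => ?_
      rw [if_neg (Nat.succ_ne_zero j)]
  have hint : ∫ x in (-T)..T, f x = ∑ j ∈ Finset.range (2 * S), ∫ x in (s j)..(s (j + 1)), f x := by
    rw [intervalIntegral.sum_integral_adjacent_intervals fun j _ => hf.intervalIntegrable _ _, hs0,
      hsN]
  have hmem : ∀ j < 2 * S, ∀ x ∈ Set.Icc (s j) (s (j + 1)), x ∈ Set.Icc (-T) T := by
    intro j hj x hx
    have h1 : (0 : ℝ) ≤ j := Nat.cast_nonneg j
    have h2 : ((j + 1 : ℕ) : ℝ) ≤ 2 * S := by exact_mod_cast hj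
    have h3 : -T ≤ s j := by
      rw [← hs0]; simp only [hs]; gcongr; exact_mod_cast Nat.zero_le j
    have h4 : s (j + 1) ≤ T := by
      rw [← hsN]; simp only [hs]; gcongr; exact_mod_cast hj
    exact ⟨h3.trans hx.1, hx.2.trans h4⟩
  have hcell : ∀ j ∈ Finset.range (2 * S),
      ‖((Δ / 2) • f (s j) + (Δ / 2) • f (s (j + 1))) - ∫ x in (s j)..(s (j + 1)), f x‖
        ≤ ε / (4 * T) * Δ := by
    intro j hj
    have hle : s j ≤ s (j + 1) := by rw [hsucc]; linarith
    have e : ((Δ / 2) • f (s j) + (Δ / 2) • f (s (j + 1))) - ∫ x in (s j)..(s (j + 1)), f x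
        = ∫ x in (s j)..(s (j + 1)),
          ((1 / 2 : ℝ) • (f (s j) - f x) + (1 / 2 : ℝ) • (f (s (j + 1)) - f x)) := by
      have e1 : ∀ x, (1 / 2 : ℝ) • (f (s j) - f x) + (1 / 2 : ℝ) • (f (s (j + 1)) - f x)
          = ((1 / 2 : ℝ) • f (s j) + (1 / 2 : ℝ) • f (s (j + 1))) - f x := fun x => by module
      simp only [e1]
      rw [intervalIntegral.integral_sub (by simp) (hf.intervalIntegrable _ _),
        intervalIntegral.integral_const, hsucc j, add_sub_cancel_left, ← hsucc j]
      module
    have hclose : ∀ x ∈ Set.Icc (s j) (s (j + 1)), ∀ y ∈ Set.Icc (s j) (s (j + 1)),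
        ‖f x - f y‖ ≤ ε / (4 * T) := by
      intro x hx y hy
      rw [← dist_eq_norm]
      refine (hfη x (hmem j (Finset.mem_range.1 hj) x hx) y (hmem j (Finset.mem_range.1 hj) y hy)
        (lt_of_le_of_lt ?_ hΔη)).le
      rw [Real.dist_eq, abs_le]
      rw [hsucc j] at hx hy
      constructor <;> linarith [hx.1, hx.2, hy.1, hy.2]
    rw [e]
    have h := intervalIntegral.norm_integral_le_of_norm_le_const (a := s j) (b := s (j + 1))
      (C := ε / (4 * T)) (f := fun x =>
        (1 / 2 : ℝ) • (f (s j) - f x) + (1 / 2 : ℝ) • (f (s (j + 1)) - f x)) fun x hx => ?_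
    · have hd : |s (j + 1) - s j| = Δ := by rw [hsucc, add_sub_cancel_left, abs_of_pos hΔ0]
      rwa [hd] at h
    · rw [Set.uIoc_of_le hle] at hx
      have hx' : x ∈ Set.Icc (s j) (s (j + 1)) := ⟨hx.1.le, hx.2⟩
      have h1 := hclose (s j) ⟨le_rfl, hle⟩ x hx'
      have h2 := hclose (s (j + 1)) ⟨hle, le_rfl⟩ x hx'
      refine (norm_add_le _ _).trans ?_
      rw [norm_smul, norm_smul, show ‖(1 / 2 : ℝ)‖ = 1 / 2 by norm_num]
      linarith
  have hsum' := hsum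
  simp only [hs] at hsum'
  rw [dist_eq_norm, hsum', hint, ← Finset.sum_sub_distrib]
  refine lt_of_le_of_lt (norm_sum_le_of_le _ hcell) ?_
  rw [Finset.sum_const, Finset.card_range, nsmul_eq_mul]
  have : ((2 * S : ℕ) : ℝ) * (ε / (4 * T) * Δ) = ε / 2 := by
    push_cast
    rw [← hSΔ]
    field_simp
    norm_num
  rw [this]
  linarith

/-- The trapezoidal approximation of the jump operator on the grid of the protocol. -/
noncomputable def gridJump (β : ℝ) (H A : Matrix d d ℂ) (S : ℕ) (Δ : ℝ) : Matrix d d ℂ :=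
  ∑ j ∈ Finset.range (2 * S + 1), trapWeight S Δ j •
    (filter β (((j : ℝ) - (S : ℝ)) * Δ) • heisenberg H A (((j : ℝ) - (S : ℝ)) * Δ))

/-- The trapezoidal approximation of the `L¹` norm of the filter on the grid of the protocol. -/
noncomputable def gridMass (β : ℝ) (S : ℕ) (Δ : ℝ) : ℝ :=
  ∑ j ∈ Finset.range (2 * S + 1), trapWeight S Δ j * ‖filter β (((j : ℝ) - (S : ℝ)) * Δ)‖

lemma tendsto_gridJump (β : ℝ) (H A : Matrix d d ℂ) {T : ℝ} (hT : 0 < T) :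
    Tendsto (fun S : ℕ => gridJump β H A S (T / S)) atTop
      (𝓝 (∫ s in (-T)..T, filter β s • heisenberg H A s)) :=
  tendsto_trapezoidal_sum (continuous_filter_smul_heisenberg β H A) hT

lemma eventually_gridMass_le {β : ℝ} (hβ : 0 < β) {T : ℝ} (hT : 0 < T) :
    ∀ᶠ S : ℕ in atTop, gridMass β S (T / S) ≤ 2 * √β := by
  have h := tendsto_trapezoidal_sum (continuous_filter β).norm hT
  have hle : ∫ s in (-T)..T, ‖filter β s‖ < 2 * √β := by
    have hb : 0 < √β := Real.sqrt_pos.2 hβ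
    have hi : Integrable fun s => ‖filter β s‖ :=
      (integrable_envelope hβ).mono' (continuous_filter β).norm.aestronglyMeasurable
        (Eventually.of_forall fun s => by simpa using norm_filter_le β s)
    rw [intervalIntegral.integral_of_le (by linarith)]
    calc _ ≤ ∫ s, ‖filter β s‖ :=
          setIntegral_le_integral hi (Eventually.of_forall fun s => norm_nonneg _)
      _ ≤ ∫ s, envelope β s := integral_mono hi (integrable_envelope hβ) (norm_filter_le β)
      _ ≤ √β := integral_envelope_le hβ
      _ < 2 * √β := by linarith
  filter_upwards [h.eventually (gt_mem_nhds hle)] with S hS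
  simpa [gridMass] using hS.le

end Filter

/-! ### Error of one step of the protocol -/

section StepError

open NormedSpace

variable {d ι : Type} [Fintype d] [DecidableEq d] [Fintype ι]

lemma isHermitian_of_mem_gridGates {H A : Matrix d d ℂ} (hH : H.IsHermitian) (hA : A.IsHermitian)
    (β γ δ : ℝ) (S : ℕ) (Δ : ℝ) : ∀ q ∈ gridGates H A β γ δ S Δ, q.1.IsHermitian := by
  intro q hq
  rw [gridGates, List.mem_append, List.mem_reverse, or_self] at hq
  obtain ⟨j, -, rfl⟩ := List.mem_map.1 hq
  exact isHermitian_heisenberg hH hA _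

lemma reverse_gridGates (H A : Matrix d d ℂ) (β γ δ : ℝ) (S : ℕ) (Δ : ℝ) :
    (gridGates H A β γ δ S Δ).reverse = gridGates H A β γ δ S Δ := by
  rw [gridGates, List.reverse_append, List.reverse_reverse]

lemma sum_map_gridGates {E : Type*} [AddCommMonoid E] (H A : Matrix d d ℂ) (β γ δ : ℝ) (S : ℕ)
    (Δ : ℝ) (f : Matrix d d ℂ × ℂ → E) :
    ((gridGates H A β γ δ S Δ).map f).sum
      = ∑ j ∈ Finset.range (2 * S + 1),
          (f (gridGate H A β γ δ S Δ j) + f (gridGate H A β γ δ S Δ j)) := by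
  have h : ∀ n : ℕ, ((List.range n).map (f ∘ gridGate H A β γ δ S Δ)).sum
      = ∑ j ∈ Finset.range n, f (gridGate H A β γ δ S Δ j) := fun n => by
    induction n with
    | zero => simp
    | succ n ih => rw [List.range_succ, List.map_append, List.sum_append, ih,
        Finset.sum_range_succ]; simp
  rw [gridGates, List.map_append, List.sum_append, List.map_reverse, List.sum_reverse,
    List.map_map, h, Finset.sum_add_distrib]

lemma trapWeight_nonneg (S : ℕ) {Δ : ℝ} (hΔ : 0 ≤ Δ) (j : ℕ) : 0 ≤ trapWeight S Δ j := by
  unfold trapWeight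
  split_ifs <;> linarith

lemma sum_gridGates (H A : Matrix d d ℂ) (β γ δ : ℝ) (S : ℕ) (Δ : ℝ) :
    ((gridGates H A β γ δ S Δ).map fun q => q.2 • q.1).sum
      = ((√(δ * γ) : ℝ) : ℂ) • gridJump β H A S Δ := by
  rw [sum_map_gridGates, gridJump, Finset.smul_sum]
  refine Finset.sum_congr rfl fun j _ => ?_
  simp only [gridGate, couplingCoeff]
  rw [← Complex.coe_smul (trapWeight S Δ j), smul_smul, smul_smul, ← add_smul]
  congr 1
  push_cast
  ring

lemma sum_norm_gridGates_le {H : Matrix d d ℂ} (hH : H.IsHermitian) (A : Matrix d d ℂ)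
    (β γ δ : ℝ) (S : ℕ) {Δ : ℝ} (hΔ : 0 ≤ Δ) :
    ((gridGates H A β γ δ S Δ).map fun q => ‖q.2‖ * ‖q.1‖).sum
      ≤ √(δ * γ) * ‖A‖ * gridMass β S Δ := by
  rw [sum_map_gridGates, gridMass, Finset.mul_sum]
  refine Finset.sum_le_sum fun j _ => ?_
  have hw := trapWeight_nonneg S hΔ j
  simp only [gridGate, couplingCoeff]
  rw [norm_mul, Complex.norm_real, Real.norm_of_nonneg (by positivity)]
  have h := norm_heisenberg_le hH A (((j : ℝ) - (S : ℝ)) * Δ)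
  have h2 := mul_le_mul_of_nonneg_left h (by positivity :
    0 ≤ √(δ * γ) * trapWeight S Δ j * ‖filter β (((j : ℝ) - (S : ℝ)) * Δ)‖)
  linarith

lemma norm_gridJump_le {H : Matrix d d ℂ} (hH : H.IsHermitian) (A : Matrix d d ℂ) (β : ℝ) (S : ℕ)
    {Δ : ℝ} (hΔ : 0 ≤ Δ) : ‖gridJump β H A S Δ‖ ≤ gridMass β S Δ * ‖A‖ := by
  rw [gridJump, gridMass, Finset.sum_mul]
  refine norm_sum_le_of_le _ fun j _ => ?_
  have hw := trapWeight_nonneg S hΔ j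
  rw [norm_smul, norm_smul, Real.norm_of_nonneg hw, mul_assoc]
  have h := norm_heisenberg_le hH A (((j : ℝ) - (S : ℝ)) * Δ)
  gcongr

lemma gridUnitary_mem_unitary {H A : Matrix d d ℂ} (hH : H.IsHermitian) (hA : A.IsHermitian)
    (β γ δ : ℝ) (S : ℕ) (Δ : ℝ) :
    gridUnitary H A β γ δ S Δ ∈ unitary (Matrix (Fin 2 × d) (Fin 2 × d) ℂ) := by
  refine Submonoid.list_prod_mem _ fun U hU => ?_
  obtain ⟨q, hq, rfl⟩ := List.mem_map.1 hU
  exact exp_mem_unitary_of_skew (conjTranspose_couplingExponent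
    (isHermitian_of_mem_gridGates hH hA β γ δ S Δ q hq) _)

/-- The constant, in terms of `κ`, of the quadratic error of one step. -/
noncomputable def stepConst (κ : ℝ) : ℝ :=
  16 * κ ^ 2 * (5 * Real.exp (2 * √κ) ^ 4 + 2 * (2 * √κ) ^ 2 * Real.exp (2 * √κ) ^ 2)
    + 20 * κ + 4 * κ ^ 2

/-- One dissipative step is a step of the semigroup generated by the discretized jump operator: its
total coupling strength is of order `√δ`, so the fourth-order error is quadratic in `δ`. -/
lemma norm_dilationDual_gridUnitary_sub_le {H A : Matrix d d ℂ} (hH : H.IsHermitian)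
    (hA : A.IsHermitian) {β γ δ κ : ℝ} (hβ : 0 < β) (hγ : 0 ≤ γ) (hδ : 0 ≤ δ) (hδ1 : δ ≤ 1)
    (hκ : γ * β * ‖A‖ ^ 2 ≤ κ) {S : ℕ} {Δ : ℝ} (hΔ : 0 ≤ Δ) (hmass : gridMass β S Δ ≤ 2 * √β) :
    ‖dilationDual (gridUnitary H A β γ δ S Δ) - 1
        - ((δ * γ : ℝ) : ℂ) • dissipatorDual (gridJump β H A S Δ)‖
      ≤ δ ^ 2 * (16 * κ ^ 2
        * (5 * Real.exp (2 * √κ) ^ 4 + 2 * (2 * √κ) ^ 2 * Real.exp (2 * √κ) ^ 2)) := by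
  have hκ0 : 0 ≤ κ := le_trans (by positivity) hκ
  set x : ℝ := √(δ * γ) * ‖A‖ * (2 * √β) with hx
  have hx0 : 0 ≤ x := by positivity
  have hxx : x ^ 2 ≤ 4 * (δ * κ) := by
    have e : x ^ 2 = 4 * (δ * (γ * β * ‖A‖ ^ 2)) := by
      rw [hx, mul_pow, mul_pow, mul_pow, Real.sq_sqrt (by positivity), Real.sq_sqrt hβ.le]
      ring
    rw [e]
    gcongr
  have hxκ : x ≤ 2 * √κ := by
    refine abs_le_of_sq_le_sq' ?_ (by positivity) |>.2
    have h2 : (2 * √κ) ^ 2 = 4 * κ := by rw [mul_pow, Real.sq_sqrt hκ0]; norm_num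
    rw [h2]
    linarith [mul_le_mul_of_nonneg_right hδ1 hκ0]
  have hx4 : x ^ 4 ≤ δ ^ 2 * (16 * κ ^ 2) := by
    calc x ^ 4 = (x ^ 2) ^ 2 := by ring
      _ ≤ (4 * (δ * κ)) ^ 2 := by gcongr
      _ = _ := by ring
  have h := norm_dilationDual_palindrome_sub_le (isHermitian_of_mem_gridGates hH hA β γ δ S Δ)
    (reverse_gridGates H A β γ δ S Δ) hx0
    ((sum_norm_gridGates_le hH A β γ δ S hΔ).trans (by rw [hx]; gcongr))
  rw [sum_gridGates, dissipatorDual_smul, Complex.norm_real,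
    Real.norm_of_nonneg (Real.sqrt_nonneg _), Real.sq_sqrt (by positivity)] at h
  refine h.trans ?_
  rw [← mul_assoc (δ ^ 2)]
  gcongr

lemma sum_mul_le_of_forall_le {p f : ι → ℝ} (hp0 : ∀ a, 0 ≤ p a) (hp1 : ∑ a, p a = 1) {c : ℝ}
    (hf : ∀ a, f a ≤ c) : ∑ a, p a * f a ≤ c := by
  calc ∑ a, p a * f a ≤ ∑ a, p a * c :=
        Finset.sum_le_sum fun a _ => mul_le_mul_of_nonneg_left (hf a) (hp0 a)
    _ = c := by rw [← Finset.sum_mul, hp1, one_mul]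

lemma norm_dissipativeDual_le {β γ κ : ℝ} (hβ : 0 < β) (hγ : 0 ≤ γ) {H : Matrix d d ℂ}
    (hH : H.IsHermitian) {A : ι → Matrix d d ℂ} {p : ι → ℝ} (hp0 : ∀ a, 0 ≤ p a)
    (hp1 : ∑ a, p a = 1) (hκ : ∀ a, γ * β * ‖A a‖ ^ 2 ≤ κ) :
    ‖dissipativeDual (fun a => jump β H (A a)) p γ‖ ≤ 2 * κ := by
  refine (norm_sum_le_of_le (f := fun a => ((γ * p a : ℝ) : ℂ) • dissipatorDual (jump β H (A a)))
    _ fun a _ => ?_).trans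
    (sum_mul_le_of_forall_le (f := fun a => 2 * (γ * β * ‖A a‖ ^ 2)) hp0 hp1 fun a => ?_)
  · rw [norm_smul, Complex.norm_real, Real.norm_of_nonneg (mul_nonneg hγ (hp0 a))]
    have h1 := norm_dissipatorDual_le (jump β H (A a))
    have h2 : ‖jump β H (A a)‖ ^ 2 ≤ β * ‖A a‖ ^ 2 := by
      rw [← Real.sq_sqrt hβ.le, ← mul_pow, Real.sq_sqrt hβ.le]
      have := norm_jump_le hβ hH (A a)
      gcongr
    calc γ * p a * ‖dissipatorDual (jump β H (A a))‖ ≤ γ * p a * (2 * (β * ‖A a‖ ^ 2)) := by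
          have := hp0 a
          gcongr
          linarith
      _ = _ := by ring
  · have := hκ a
    linarith

lemma norm_commutator_dissipativeDual_le {β γ κ : ℝ} (hβ : 0 < β) (hγ : 0 ≤ γ) {H : Matrix d d ℂ}
    (hH : H.IsHermitian) {A : ι → Matrix d d ℂ} {p : ι → ℝ} (hp0 : ∀ a, 0 ≤ p a)
    (hp1 : ∑ a, p a = 1) (hκ : ∀ a, γ * ‖A a‖ ^ 2 ≤ κ) :
    ‖hamiltonianDual H * dissipativeDual (fun a => jump β H (A a)) p γ
        - dissipativeDual (fun a => jump β H (A a)) p γ * hamiltonianDual H‖ ≤ 20 * κ := by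
  have e : hamiltonianDual H * dissipativeDual (fun a => jump β H (A a)) p γ
        - dissipativeDual (fun a => jump β H (A a)) p γ * hamiltonianDual H
      = ∑ a, ((γ * p a : ℝ) : ℂ) • (hamiltonianDual H * dissipatorDual (jump β H (A a))
        - dissipatorDual (jump β H (A a)) * hamiltonianDual H) := by
    ext1 Y
    simp only [dissipativeDual, _root_.sub_apply, mul_apply_eq_comp, _root_.sum_apply,
      _root_.smul_apply, map_sum, map_smul, smul_sub, Finset.sum_sub_distrib]
  rw [e]
  refine (norm_sum_le_of_le _ fun a _ => ?_).trans
    (sum_mul_le_of_forall_le (f := fun a => 20 * (γ * ‖A a‖ ^ 2)) hp0 hp1 fun a => ?_)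
  · rw [norm_smul, Complex.norm_real, Real.norm_of_nonneg (mul_nonneg hγ (hp0 a))]
    have hb : 0 < √β := Real.sqrt_pos.2 hβ
    have h2 : 4 * ‖jump β H (A a)‖ * ‖H * jump β H (A a) - jump β H (A a) * H‖
        ≤ 4 * (√β * ‖A a‖) * (5 / √β * ‖A a‖) := by
      have h3 := norm_jump_le hβ hH (A a)
      have h4 := norm_commutator_jump_le hβ hH (A a)
      gcongr
    have h5 : 4 * (√β * ‖A a‖) * (5 / √β * ‖A a‖) = 20 * ‖A a‖ ^ 2 := by
      field_simp
      ring
    calc _ ≤ γ * p a * (20 * ‖A a‖ ^ 2) := by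
          have := hp0 a
          gcongr
          exact (norm_hamiltonianDual_commutator_le hH _).trans (h2.trans h5.le)
      _ = _ := by ring
  · have := hκ a
    linarith

lemma norm_meanStepDual_le {H : Matrix d d ℂ} (hH : H.IsHermitian) {A : ι → Matrix d d ℂ}
    (hA : ∀ a, (A a).IsHermitian) {p : ι → ℝ} (hp0 : ∀ a, 0 ≤ p a) (hp1 : ∑ a, p a = 1)
    (β γ δ : ℝ) (S : ℕ) (Δ : ℝ) : ‖meanStepDual H A p β γ δ S Δ‖ ≤ 1 := by
  have h1 : ‖sandwich (evolution H (-δ)) (evolution H δ)‖ ≤ 1 := by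
    rw [← exp_smul_hamiltonianDual]
    exact norm_exp_hamiltonianDual_le hH δ
  have h2 : ‖∑ a, (p a : ℂ) • dilationDual (gridUnitary H (A a) β γ δ S Δ)‖ ≤ 1 := by
    refine (norm_sum_le_of_le _ fun a _ => ?_).trans
      (sum_mul_le_of_forall_le (f := fun _ => (1 : ℝ)) hp0 hp1 fun a => le_rfl)
    rw [norm_smul, Complex.norm_real, Real.norm_of_nonneg (hp0 a)]
    have := norm_dilationDual_le (gridUnitary_mem_unitary hH (hA a) β γ δ S Δ)
    have := hp0 a
    gcongr
  exact (ContinuousLinearMap.opNorm_comp_le _ _).trans (mul_le_one₀ h1 (norm_nonneg _) h2)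

/-- The error of one step is quadratic in its length, uniformly in the Hamiltonian, up to the error
`τ` in the jump operators. -/
lemma norm_meanStepDual_sub_exp_le {H : Matrix d d ℂ} (hH : H.IsHermitian) {A : ι → Matrix d d ℂ}
    (hA : ∀ a, (A a).IsHermitian) {p : ι → ℝ} (hp0 : ∀ a, 0 ≤ p a) (hp1 : ∑ a, p a = 1)
    {β γ δ κ τ : ℝ} (hβ : 0 < β) (hγ : 0 ≤ γ) (hδ : 0 ≤ δ)
    (hκ1 : ∀ a, γ * ‖A a‖ ^ 2 ≤ κ) (hκ : ∀ a, γ * β * ‖A a‖ ^ 2 ≤ κ) (hκ0 : 0 ≤ κ)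
    {S : ℕ} {Δ : ℝ} (hΔ : 0 ≤ Δ) (hmass : gridMass β S Δ ≤ 2 * √β)
    (hτ0 : 0 ≤ τ)
    (hτ : ∀ a, γ * (6 * √β * ‖A a‖) * ‖gridJump β H (A a) S Δ - jump β H (A a)‖ ≤ τ) :
    ‖exp ((δ : ℂ) • lindbladianDual H (fun a => jump β H (A a)) p γ)
        - meanStepDual H A p β γ δ S Δ‖
      ≤ (stepConst κ + 2) * δ ^ 2 + δ * τ := by
  have hC : 0 ≤ stepConst κ := by unfold stepConst; positivity
  have hexp := norm_exp_lindbladianDual_le hH (fun a => jump β H (A a)) hp0 hγ (s := δ) hδ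
  rcases lt_or_ge 1 δ with h1 | hδ1
  -- long steps: both sides are contractions
  · have h2 := norm_meanStepDual_le hH hA hp0 hp1 β γ δ S Δ
    refine (norm_sub_le _ _).trans ?_
    nlinarith [mul_nonneg hC (sq_nonneg δ), mul_nonneg hδ hτ0]
  set P := hamiltonianDual H with hP
  set Q := dissipativeDual (fun a => jump β H (A a)) p γ with hQ
  have hsplit := norm_exp_add_sub_exp_mul_le (𝔸 := Matrix d d ℂ →L[ℂ] Matrix d d ℂ) P Q
    (norm_exp_hamiltonianDual_le hH)
    (fun s hs => norm_exp_lindbladianDual_le hH (fun a => jump β H (A a)) hp0 hγ hs) hδ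
  have hQn : ‖Q‖ ≤ 2 * κ := norm_dissipativeDual_le hβ hγ hH hp0 hp1 hκ
  have hPQ : ‖P * Q - Q * P‖ ≤ 20 * κ := norm_commutator_dissipativeDual_le hβ hγ hH hp0 hp1 hκ1
  set K : ℝ := 16 * κ ^ 2
    * (5 * Real.exp (2 * √κ) ^ 4 + 2 * (2 * √κ) ^ 2 * Real.exp (2 * √κ) ^ 2) with hK
  have hdil : ‖(1 + (δ : ℂ) • Q)
      - ∑ a, (p a : ℂ) • dilationDual (gridUnitary H (A a) β γ δ S Δ)‖ ≤ δ ^ 2 * K + δ * τ := by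
    have hp1' : ∑ a, (p a : ℂ) = 1 := by exact_mod_cast hp1
    have e : (1 + (δ : ℂ) • Q) - ∑ a, (p a : ℂ) • dilationDual (gridUnitary H (A a) β γ δ S Δ)
        = ∑ a, (p a : ℂ) • (((δ * γ : ℝ) : ℂ) •
            (dissipatorDual (jump β H (A a)) - dissipatorDual (gridJump β H (A a) S Δ))
          - (dilationDual (gridUnitary H (A a) β γ δ S Δ) - 1
            - ((δ * γ : ℝ) : ℂ) • dissipatorDual (gridJump β H (A a) S Δ))) := by
      have e1 : (1 : Matrix d d ℂ →L[ℂ] Matrix d d ℂ) = ∑ a, (p a : ℂ) • 1 := by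
        rw [← Finset.sum_smul, hp1', one_smul]
      rw [e1, hQ, dissipativeDual, Finset.smul_sum, ← Finset.sum_add_distrib,
        ← Finset.sum_sub_distrib]
      refine Finset.sum_congr rfl fun a _ => ?_
      rw [← e1]
      push_cast
      module
    rw [e]
    refine (norm_sum_le_of_le _ fun a _ => ?_).trans
      (sum_mul_le_of_forall_le (f := fun _ => δ ^ 2 * K + δ * τ) hp0 hp1 fun a => le_rfl)
    rw [norm_smul, Complex.norm_real, Real.norm_of_nonneg (hp0 a)]
    refine mul_le_mul_of_nonneg_left ?_ (hp0 a)
    refine (norm_sub_le _ _).trans ?_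
    have h2 := norm_dilationDual_gridUnitary_sub_le hH (hA a) hβ hγ hδ hδ1 (hκ a) hΔ hmass
    have h3 : ‖((δ * γ : ℝ) : ℂ) •
        (dissipatorDual (jump β H (A a)) - dissipatorDual (gridJump β H (A a) S Δ))‖ ≤ δ * τ := by
      rw [norm_smul, Complex.norm_real, Real.norm_of_nonneg (mul_nonneg hδ hγ), mul_assoc]
      refine mul_le_mul_of_nonneg_left (le_trans ?_ (hτ a)) hδ
      rw [mul_assoc]
      refine mul_le_mul_of_nonneg_left ((norm_dissipatorDual_sub_le _ _).trans ?_) hγ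
      rw [norm_sub_rev]
      refine mul_le_mul_of_nonneg_right ?_ (norm_nonneg _)
      have h4 := norm_jump_le hβ hH (A a)
      have h5 := (norm_gridJump_le hH (A a) β S hΔ).trans
        (mul_le_mul_of_nonneg_right hmass (norm_nonneg (A a)))
      linarith
    linarith
  have e : exp ((δ : ℂ) • lindbladianDual H (fun a => jump β H (A a)) p γ)
        - meanStepDual H A p β γ δ S Δ
      = (exp ((δ : ℂ) • (P + Q)) - exp ((δ : ℂ) • P) * (1 + (δ : ℂ) • Q))
        + exp ((δ : ℂ) • P) * ((1 + (δ : ℂ) • Q)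
          - ∑ a, (p a : ℂ) • dilationDual (gridUnitary H (A a) β γ δ S Δ)) := by
    rw [meanStepDual, ← exp_smul_hamiltonianDual, mul_sub, lindbladianDual]
    abel
  have hlast : ‖exp ((δ : ℂ) • P) * ((1 + (δ : ℂ) • Q)
      - ∑ a, (p a : ℂ) • dilationDual (gridUnitary H (A a) β γ δ S Δ))‖ ≤ δ ^ 2 * K + δ * τ :=
    (ContinuousLinearMap.opNorm_comp_le _ _).trans
      ((mul_le_of_le_one_left (norm_nonneg _) (norm_exp_hamiltonianDual_le hH δ)).trans hdil)
  rw [e]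
  refine (norm_add_le _ _).trans ?_
  have h6 : ‖P * Q - Q * P‖ + ‖Q‖ ^ 2 ≤ 20 * κ + (2 * κ) ^ 2 := by gcongr
  have h7 := mul_le_mul_of_nonneg_left h6 (sq_nonneg δ)
  have h8 : (stepConst κ + 2) * δ ^ 2 = δ ^ 2 * K + δ ^ 2 * (20 * κ + (2 * κ) ^ 2) + 2 * δ ^ 2 := by
    rw [stepConst, ← hK]
    ring
  rw [h8]
  linarith [sq_nonneg δ]

end StepError

/-! ### Error and cost of the whole protocol -/

section Protocol

open NormedSpace Filter Topology

variable {d ι : Type}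

lemma simulationTime_append (c c' : List (Op ι)) :
    simulationTime (c ++ c') = simulationTime c + simulationTime c' := by
  simp [simulationTime]

lemma simulationTime_flatMap {α : Type*} (l : List α) (f : α → List (Op ι)) {r : ℝ}
    (h : ∀ a, simulationTime (f a) = r) : simulationTime (l.flatMap f) = l.length * r := by
  induction l with
  | nil => simp [simulationTime]
  | cons a l ih =>
    rw [List.flatMap_cons, simulationTime_append, ih, h, List.length_cons]
    push_cast
    ring

lemma simulationTime_protocol (β γ : ℝ) {δ : ℝ} (hδ : 0 ≤ δ) (S : ℕ) {Δ : ℝ} (hΔ : 0 ≤ Δ)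
    (as : List ι) :
    simulationTime (protocol β γ δ S Δ as) = as.length * (δ + 4 * (S * Δ)) + 2 * (S * Δ) := by
  have hSΔ : 0 ≤ S * Δ := by positivity
  have hstep : ∀ a : ι, simulationTime (protocolStep β γ δ S Δ a) = δ + 4 * (S * Δ) := fun a => by
    rw [protocolStep, productFormula, simulationTime_append, simulationTime_append,
      simulationTime_append, simulationTime_append,
      simulationTime_flatMap (r := Δ) _ _ (by simp [simulationTime, Op.time, abs_of_nonneg hΔ]),
      simulationTime_flatMap (r := Δ) _ _ (by simp [simulationTime, Op.time, abs_of_nonneg hΔ])]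
    simp [simulationTime, Op.time, abs_of_nonneg hδ]
    ring
  rw [protocol, simulationTime_append, simulationTime_append, simulationTime_flatMap _ _ hstep]
  simp [simulationTime, Op.time, abs_of_nonneg hSΔ]
  ring

variable [Fintype d] [DecidableEq d] [Fintype ι]

/-- Passage to the Heisenberg picture: the error on states is bounded by the error on
observables. -/
lemma traceNorm_exp_sub_protocolOutput_le {H : Matrix d d ℂ} (hH : H.IsHermitian)
    (L A : ι → Matrix d d ℂ) {p : ι → ℝ} (hp1 : ∑ a, p a = 1)
    (β γ t : ℝ) (M S : ℕ) (Δ : ℝ) {ρ : Matrix d d ℂ} (hρ : IsDensity ρ) :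
    traceNorm (exp ((t : ℂ) • lindbladian H L p γ) ρ - protocolOutput H A p β γ t M S Δ ρ)
      ≤ ‖exp ((t : ℂ) • lindbladianDual H L p γ) - meanStepDual H A p β γ (t / M) S Δ ^ M‖ := by
  refine traceNorm_le_of_forall_trace_le _ fun Y hY => ?_
  have h := ((isTraceDual_lindbladian H L hp1 γ).smul (t : ℂ)).exp
  rw [mul_sub, Matrix.trace_sub, h, trace_mul_protocolOutput hH, ← Matrix.trace_sub, ← sub_mul,
    ← _root_.sub_apply]
  exact (norm_trace_mul_density_le hρ _).trans
    ((ContinuousLinearMap.le_opNorm _ _).trans (mul_le_of_le_one_right (norm_nonneg _) hY))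

/-- The errors of the single steps add up, since both evolutions are contractive. -/
lemma norm_exp_sub_meanStepDual_pow_le {H : Matrix d d ℂ} (hH : H.IsHermitian)
    {A : ι → Matrix d d ℂ} (hA : ∀ a, (A a).IsHermitian) {p : ι → ℝ} (hp0 : ∀ a, 0 ≤ p a)
    (hp1 : ∑ a, p a = 1) {β γ t κ τ : ℝ} (hβ : 0 < β) (hγ : 0 ≤ γ) (ht : 0 ≤ t)
    (hκ1 : ∀ a, γ * ‖A a‖ ^ 2 ≤ κ) (hκ : ∀ a, γ * β * ‖A a‖ ^ 2 ≤ κ) (hκ0 : 0 ≤ κ)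
    {M : ℕ} (hM : 0 < M) {S : ℕ} {Δ : ℝ} (hΔ : 0 ≤ Δ) (hmass : gridMass β S Δ ≤ 2 * √β)
    (hτ0 : 0 ≤ τ)
    (hτ : ∀ a, γ * (6 * √β * ‖A a‖) * ‖gridJump β H (A a) S Δ - jump β H (A a)‖ ≤ τ) :
    ‖exp ((t : ℂ) • lindbladianDual H (fun a => jump β H (A a)) p γ)
        - meanStepDual H A p β γ (t / M) S Δ ^ M‖
      ≤ (stepConst κ + 2) * t ^ 2 / M + t * τ := by
  have hM' : (0 : ℝ) < M := by exact_mod_cast hM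
  set G := lindbladianDual H (fun a => jump β H (A a)) p γ with hG
  have hδ : 0 ≤ t / M := by positivity
  have hpow : exp ((t : ℂ) • G) = exp (((t / M : ℝ) : ℂ) • G) ^ M := by
    let _ : NormedAlgebra ℚ (Matrix d d ℂ →L[ℂ] Matrix d d ℂ) :=
      NormedAlgebra.restrictScalars ℚ ℂ _
    rw [← NormedSpace.exp_nsmul (𝔸 := Matrix d d ℂ →L[ℂ] Matrix d d ℂ)]
    congr 1
    rw [← Nat.cast_smul_eq_nsmul ℂ, smul_smul]
    congr 1
    push_cast
    field_simp
  rw [hpow]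
  refine (norm_pow_sub_pow_le (𝔸 := Matrix d d ℂ →L[ℂ] Matrix d d ℂ)
    (norm_exp_lindbladianDual_le hH _ hp0 hγ hδ)
    (norm_meanStepDual_le hH hA hp0 hp1 β γ (t / M) S Δ) M).trans ?_
  refine (mul_le_mul_of_nonneg_left (norm_meanStepDual_sub_exp_le hH hA hp0 hp1 hβ hγ hδ hκ1 hκ hκ0
    hΔ hmass hτ0 hτ) hM'.le).trans (le_of_eq ?_)
  field_simp

/-- On a fine enough grid of half-width `T` the jump operators are accurate up to twice any positive
bound on the error of truncating the filter to `[-T, T]`. -/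
lemma eventually_gridJump_sub_jump_le {H : Matrix d d ℂ} (hH : H.IsHermitian)
    (A : ι → Matrix d d ℂ) {β γ T τ : ℝ} (hβ : 0 < β) (hγ : 0 ≤ γ) (hT : 0 < T) (hτ : 0 < τ)
    (htail : ∀ a, γ * (6 * √β * ‖A a‖) * (Real.exp (-(T / β) ^ 2) * (√β * ‖A a‖)) ≤ τ) :
    ∀ᶠ S : ℕ in atTop, ∀ a,
      γ * (6 * √β * ‖A a‖) * ‖gridJump β H (A a) S (T / S) - jump β H (A a)‖ ≤ 2 * τ := by
  refine eventually_all.2 fun a => ?_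
  have h1 := ((tendsto_gridJump β H (A a) hT).sub_const
    (∫ s in (-T)..T, filter β s • heisenberg H (A a) s)).norm.const_mul
      (γ * (6 * √β * ‖A a‖))
  rw [sub_self, norm_zero, mul_zero] at h1
  filter_upwards [h1.eventually (gt_mem_nhds hτ)] with S hS
  have h2 := norm_jump_sub_truncated_le hβ hH (A a) hT.le
  set LT := ∫ s in (-T)..T, filter β s • heisenberg H (A a) s
  have h3 : ‖gridJump β H (A a) S (T / S) - jump β H (A a)‖
      ≤ ‖gridJump β H (A a) S (T / S) - LT‖ + ‖jump β H (A a) - LT‖ := by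
    rw [norm_sub_rev (jump β H (A a))]
    exact norm_sub_le_norm_sub_add_norm_sub _ _ _
  have hc : 0 ≤ γ * (6 * √β * ‖A a‖) := by positivity
  have h4 := mul_le_mul_of_nonneg_left h3 hc
  have h5 := mul_le_mul_of_nonneg_left h2 hc
  linarith [htail a]

end Protocol

/-- The truncation radius `β √((1 + 24 κ / log 2) log (β t / ε))` makes the tail of the filter
negligible over the whole evolution. -/
lemma tail_le {κ β t ε : ℝ} (hκ : 0 < κ) (hβ : 0 < β) (ht : 0 < t) (hε : 0 < ε)
    (hr : 2 ≤ β * t / ε) :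
    6 * κ * β * Real.exp (-((1 + 24 * κ / Real.log 2) * Real.log (β * t / ε))) ≤ ε / (4 * t) := by
  have hl2 : 0 < Real.log 2 := Real.log_pos one_lt_two
  have hl : Real.log 2 ≤ Real.log (β * t / ε) := Real.log_le_log two_pos hr
  set l := Real.log (β * t / ε) with hldef
  have hrl : Real.exp (-l) = ε / (β * t) := by
    rw [Real.exp_neg, hldef, Real.exp_log (by positivity), inv_div]
  have h1 : Real.exp (-((1 + 24 * κ / Real.log 2) * l))
      ≤ ε / (β * t) * Real.exp (-(24 * κ)) := by
    rw [← hrl, ← Real.exp_add]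
    gcongr
    have : 24 * κ ≤ 24 * κ / Real.log 2 * l := by
      rw [div_mul_eq_mul_div, le_div_iff₀ hl2]
      gcongr
    linarith
  have h2 : 24 * κ * Real.exp (-(24 * κ)) ≤ 1 := by
    have h3 : 24 * κ ≤ Real.exp (24 * κ) := by linarith [Real.add_one_le_exp (24 * κ)]
    calc 24 * κ * Real.exp (-(24 * κ)) ≤ Real.exp (24 * κ) * Real.exp (-(24 * κ)) := by gcongr
      _ = 1 := by rw [← Real.exp_add, add_neg_cancel, Real.exp_zero]
  calc _ ≤ 6 * κ * β * (ε / (β * t) * Real.exp (-(24 * κ))) := by gcongr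
    _ = ε / (4 * t) * (24 * κ * Real.exp (-(24 * κ))) := by
        field_simp
        ring
    _ ≤ ε / (4 * t) * 1 := by gcongr
    _ = _ := mul_one _

end LindbladSim

theorem mainTheorem2 (κ : ℝ) (hκ : 0 < κ) :
    ∃ c C : ℝ, 0 < c ∧ 0 < C ∧
      ∀ (d ι : Type) [Fintype d] [DecidableEq d] [Fintype ι]
        (H : Matrix d d ℂ) (A : ι → Matrix d d ℂ) (p : ι → ℝ) (γ β t ε : ℝ),
        H.IsHermitian → (∀ a, (A a).IsHermitian) →
        (∀ a, 0 ≤ p a) → ∑ a, p a = 1 →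
        0 ≤ γ → 0 < β → 0 < t → 0 < ε →
        (∀ a, γ * max 1 β * ‖A a‖ ^ 2 ≤ κ) →
        2 ≤ β * t / ε → ε ≤ t ^ 2 →
        ∃ (M S : ℕ) (Δ : ℝ), 0 < M ∧ 0 < S ∧ 0 < Δ ∧
          (∀ ρ : Matrix d d ℂ, LindbladSim.IsDensity ρ →
            LindbladSim.traceNorm
              (NormedSpace.exp ((t : ℂ) •
                  LindbladSim.lindbladian H (fun a => LindbladSim.jump β H (A a)) p γ) ρ
                - LindbladSim.protocolOutput H A p β γ t M S Δ ρ) ≤ ε) ∧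
          (∀ a : Fin M → ι,
            c * LindbladSim.rate β t ε ≤ LindbladSim.simulationTime
                (LindbladSim.protocol β γ (t / M) S Δ (List.ofFn a)) ∧
            LindbladSim.simulationTime
                (LindbladSim.protocol β γ (t / M) S Δ (List.ofFn a))
              ≤ C * LindbladSim.rate β t ε) := by
  open LindbladSim Filter in
  have hl2 : 0 < Real.log 2 := Real.log_pos one_lt_two
  set c₀ : ℝ := 1 + 24 * κ / Real.log 2 with hc₀
  have hc₀0 : 0 < c₀ := by positivity
  have hs0 : 0 < √c₀ := Real.sqrt_pos.2 hc₀0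
  set C₁ : ℝ := 2 * (stepConst κ + 2) with hC₁
  have hC₁0 : 4 ≤ C₁ := by
    have : 0 ≤ stepConst κ := by unfold stepConst; positivity
    linarith
  -- both constants are read off from the simulation time `t + 4 M T + 2 T`
  refine ⟨4 * C₁ * √c₀, 4 * (C₁ + 1) * √c₀ + 2 * √c₀ + 1, by positivity, by positivity, ?_⟩
  intro d ι _ _ _ H A p γ β t ε hH hA hp0 hp1 hγ hβ ht hε hκA hr hεt
  have hl : Real.log 2 ≤ Real.log (β * t / ε) := Real.log_le_log two_pos hr
  set l := Real.log (β * t / ε) with hldef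
  have hl0 : 0 < l := hl2.trans_le hl
  have hκ1 : ∀ a, γ * ‖A a‖ ^ 2 ≤ κ := fun a => by
    refine le_trans ?_ (hκA a)
    gcongr
    exact le_mul_of_one_le_right hγ (le_max_left _ _)
  have hκβ : ∀ a, γ * β * ‖A a‖ ^ 2 ≤ κ := fun a => by
    refine le_trans ?_ (hκA a)
    gcongr
    exact le_max_right _ _
  -- the truncation radius of the filter, and the number of steps; either error costs `ε / 2`
  set T : ℝ := β * √(c₀ * l) with hT
  have hT0 : 0 < T := by positivity
  set M : ℕ := ⌈C₁ * t ^ 2 / ε⌉₊ with hM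
  have hu : 1 ≤ t ^ 2 / ε := (one_le_div hε).2 hεt
  have hMl : C₁ * (t ^ 2 / ε) ≤ M := by
    rw [← mul_div_assoc]
    exact Nat.le_ceil _
  have hMu : (M : ℝ) ≤ (C₁ + 1) * (t ^ 2 / ε) := by
    have h : (M : ℝ) < C₁ * t ^ 2 / ε + 1 := Nat.ceil_lt_add_one (by positivity)
    rw [mul_div_assoc] at h
    linarith
  have hM0 : 0 < M := by
    have : (0 : ℝ) < M := lt_of_lt_of_le (by positivity) hMl
    exact_mod_cast this
  have hM0' : (0 : ℝ) < M := by exact_mod_cast hM0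
  have htail : ∀ a, γ * (6 * √β * ‖A a‖) * (Real.exp (-(T / β) ^ 2) * (√β * ‖A a‖))
      ≤ ε / (4 * t) := fun a => by
    have hTβ : (T / β) ^ 2 = c₀ * l := by
      rw [hT, mul_div_cancel_left₀ _ hβ.ne', Real.sq_sqrt (by positivity)]
    have hb : √β * √β = β := Real.mul_self_sqrt hβ.le
    rw [hTβ]
    calc _ = 6 * (γ * ‖A a‖ ^ 2) * (√β * √β) * Real.exp (-(c₀ * l)) := by ring
      _ ≤ 6 * κ * β * Real.exp (-(c₀ * l)) := by
          rw [hb]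
          have := hκ1 a
          gcongr
      _ ≤ ε / (4 * t) := tail_le hκ hβ ht hε hr
  -- the remaining errors are below their bounds on every fine enough grid
  obtain ⟨S, ⟨hSmass, hSjump⟩, hS0⟩ := (((eventually_gridMass_le hβ hT0).and
    (eventually_gridJump_sub_jump_le hH A hβ hγ hT0 (by positivity) htail)).and
      (eventually_gt_atTop 0)).exists
  have hS0' : (0 : ℝ) < S := by exact_mod_cast hS0
  have hΔ : 0 < T / S := by positivity
  refine ⟨M, S, T / S, hM0, hS0, hΔ, fun ρ hρ => ?_, fun a => ?_⟩
  · refine (traceNorm_exp_sub_protocolOutput_le hH _ A hp1 β γ t M S (T / S) hρ).trans ?_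
    refine (norm_exp_sub_meanStepDual_pow_le hH hA hp0 hp1 hβ hγ ht.le hκ1 hκβ hκ.le hM0 hΔ.le
      hSmass (by positivity) hSjump).trans ?_
    have h1 : (stepConst κ + 2) * t ^ 2 / M ≤ ε / 2 := by
      rw [div_le_iff₀ hM0']
      have h2 := mul_le_mul_of_nonneg_left hMl (by positivity : 0 ≤ ε / 2)
      have h3 : ε / 2 * (C₁ * (t ^ 2 / ε)) = (stepConst κ + 2) * t ^ 2 := by
        rw [hC₁]
        field_simp
      linarith
    have h2 : t * (2 * (ε / (4 * t))) = ε / 2 := by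
      field_simp
      norm_num
    linarith
  · have hST : S * (T / S) = T := by field_simp
    have htime : simulationTime (protocol β γ (t / M) S (T / S) (List.ofFn a))
        = t + 4 * (M * T) + 2 * T := by
      rw [simulationTime_protocol β γ (by positivity) S hΔ.le, List.length_ofFn, hST]
      field_simp
    have hTeq : T = √c₀ * (β * √l) := by
      rw [hT, Real.sqrt_mul hc₀0.le]
      ring
    have hrate : rate β t ε = t ^ 2 / ε * (β * √l) := by
      rw [rate, ← hldef]
      ring
    have hB : 0 < β * √l := by positivity
    have hMT_low : C₁ * √c₀ * rate β t ε ≤ M * T := by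
      rw [hrate, hTeq]
      have := mul_le_mul_of_nonneg_right hMl (by positivity : 0 ≤ √c₀ * (β * √l))
      linarith
    have hMT_up : M * T ≤ (C₁ + 1) * √c₀ * rate β t ε := by
      rw [hrate, hTeq]
      have := mul_le_mul_of_nonneg_right hMu (by positivity : 0 ≤ √c₀ * (β * √l))
      linarith
    have hT_up : T ≤ √c₀ * rate β t ε := by
      rw [hrate, hTeq]
      have := mul_le_mul_of_nonneg_right hu (by positivity : 0 ≤ √c₀ * (β * √l))
      linarith
    have ht_up : t ≤ rate β t ε := by
      have h1 : (1 / 2 : ℝ) ≤ √l := by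
        apply Real.le_sqrt_of_sq_le
        linarith [Real.log_two_gt_d9]
      have h2 : rate β t ε = t * (β * t / ε * √l) := by
        rw [rate, ← hldef]
        ring
      have h3 : 1 ≤ β * t / ε * √l := by nlinarith
      rw [h2]
      exact le_mul_of_one_le_right ht.le h3
    rw [htime]
    constructor
    · linarith
    · linarith
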